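/- Let $\mathcal H_n$ ($n\ge 0$) be the Hecke algebra over $\mathbb C(q)$, $q$ a formal variable, generated by $T_1,\dots,T_{n-1}$ subject to $T_iT_{i+1}T_i=T_{i+1}T_iT_{i+1}$, $T_iT_j=T_jT_i$ for $|i-j|>1$, and $T_i^2=1+(q-q^{-1})T_i$ (so $\mathcal H_0=\mathcal H_1=\mathbb C(q)$), and regard $\mathcal H_m$ as a subalgebra of $\mathcal H_{m+1}$ via $T_i\mapsto T_i$. Let $y_1=1$ and $y_{k+1}=T_ky_kT_k$ be the Jucys–Murphy elements. The $q$-content of a cell in row $i$ and column $j$ is $q^{2(j-i)}$. For a standard tableau $\mathcal T$ with $n$ cells define $E_{\mathcal T}\in\mathcal H_n$ inductively: $E_{\mathcal T}=1$ if $n\le 1$, and for $n\ge 2$ $$E_{\mathcal T}=E_{\mathcal U}\,\frac{(y_n-\rho_1)\cdots(y_n-\rho_k)}{(\sigma-\rho_1)\cdots(\sigma-\rho_k)},$$ where $\mathcal U$ is obtained from $\mathcal T$ by removing the cell $\alpha$ occupied by $n$, $\mu$ is the shape of $\mathcal U$, $\rho_1,\dots,\rho_k$ are the $q$-contents of all cells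 addable to $\mu$ except $\alpha$, and $\sigma$ is the $q$-content of $\alpha$. Fix a parameter $Q\in\mathbb C(q)$. There is a unique family of $\mathbb C(q)$-linear maps $\mathrm{Tr}_{m+1}:\mathcal H_{m+1}\to\mathcal H_m$ ($m\ge 0$) such that, for all $X,Y\in\mathcal H_m$ and $Z\in\mathcal H_{m+1}$, $$\mathrm{Tr}_{m+1}(XZY)=X\,\mathrm{Tr}_{m+1}(Z)\,Y,\qquad \mathrm{Tr}_{m+1}(X)=QX,$$ and, for $m\ge 1$, $$\mathrm{Tr}_{m+1}(T_m^{\pm1}XT_m^{\mp1})=\mathrm{Tr}_m(X),\qquad \mathrm{Tr}_{m+1}(T_m)=1,\qquad \mathrm{Tr}_m\mathrm{Tr}_{m+1}(T_mZ)=\mathrm{Tr}_m\mathrm{Tr}_{m+1}(ZT_m).$$ Let $\mathrm{Tr}^{(n)}=\mathrm{Tr}_1\mathrm{Tr}_2\cdots\mathrm{Tr}_n:\mathcal H_n\to\mathcal H_0=\mathbb C(q)$ be the resulting Ocneanu–Markov trace. If $\mathcal T$ and $\mathcal T'$ are standard tableaux with $n$ cells and the same shape $\lambda$, then $$\mathrm{Tr}^{(n)}(E_{\mathcal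 T})=\mathrm{Tr}^{(n)}(E_{\mathcal T'}),$$ i.e. $\mathrm{Tr}^{(n)}(E_{\mathcal T})$ depends only on the shape of $\mathcal T$. -/

import Mathlib

noncomputable section

namespace HeckeTrace

/-- The ground field `ℂ(q)`. -/
abbrev K : Type := RatFunc ℂ

/-- The formal variable `q`. -/
def q : K := RatFunc.X

/-- The indices `1, …, n - 1` of the generators of the `n`-th Hecke algebra. -/
abbrev Idx (n : ℕ) : Type := {i : ℕ // 1 ≤ i ∧ i < n}

/-- The defining relations of the Hecke algebra. -/
inductive Rel (n : ℕ) : FreeAlgebra K (Idx n) → FreeAlgebra K (Idx n) → Prop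
  | braid (i j : Idx n) (h : j.1 = i.1 + 1) :
      Rel n (FreeAlgebra.ι K i * FreeAlgebra.ι K j * FreeAlgebra.ι K i)
        (FreeAlgebra.ι K j * FreeAlgebra.ι K i * FreeAlgebra.ι K j)
  | comm (i j : Idx n) (h : i.1 + 1 < j.1 ∨ j.1 + 1 < i.1) :
      Rel n (FreeAlgebra.ι K i * FreeAlgebra.ι K j)
        (FreeAlgebra.ι K j * FreeAlgebra.ι K i)
  | quad (i : Idx n) :
      Rel n (FreeAlgebra.ι K i * FreeAlgebra.ι K i)
        (1 + (q - q⁻¹) • FreeAlgebra.ι K i)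

/-- The Hecke algebra `H_n` over `ℂ(q)`, by generators and relations. -/
abbrev Hecke (n : ℕ) : Type := RingQuot (Rel n)

/-- The generator `T_i` of `H_n`, for `1 ≤ i < n`. -/
def gen {n : ℕ} (i : Idx n) : Hecke n :=
  RingQuot.mkAlgHom K (Rel n) (FreeAlgebra.ι K i)

theorem gen_braid {n : ℕ} (i j : Idx n) (h : j.1 = i.1 + 1) :
    gen i * gen j * gen i = gen j * gen i * gen j := by
  simpa [gen] using RingQuot.mkAlgHom_rel K (Rel.braid i j h)

theorem gen_comm {n : ℕ} (i j : Idx n) (h : i.1 + 1 < j.1 ∨ j.1 + 1 < i.1) :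
    gen i * gen j = gen j * gen i := by
  simpa [gen] using RingQuot.mkAlgHom_rel K (Rel.comm i j h)

theorem gen_quad {n : ℕ} (i : Idx n) :
    gen i * gen i = 1 + (q - q⁻¹) • gen i := by
  simpa [gen] using RingQuot.mkAlgHom_rel K (Rel.quad i)

/-- The generator `T_i` as a unit of `H_n`; its inverse is `T_i - (q - q⁻¹)`. -/
def genUnit {n : ℕ} (i : Idx n) : (Hecke n)ˣ where
  val := gen i
  inv := gen i - (q - q⁻¹) • (1 : Hecke n)
  val_inv := by simp [mul_sub, gen_quad]
  inv_val := by simp [sub_mul, gen_quad]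

/-- The universal property of `H_n`. -/
def lift {n : ℕ} {A : Type} [Ring A] [Algebra K A] (t : Idx n → A)
    (hb : ∀ i j : Idx n, j.1 = i.1 + 1 → t i * t j * t i = t j * t i * t j)
    (hc : ∀ i j : Idx n, i.1 + 1 < j.1 ∨ j.1 + 1 < i.1 → t i * t j = t j * t i)
    (hq : ∀ i : Idx n, t i * t i = 1 + (q - q⁻¹) • t i) : Hecke n →ₐ[K] A :=
  RingQuot.liftAlgHom K ⟨FreeAlgebra.lift K t, by
    intro x y h
    cases h with
    | braid i j h => simpa using hb i j h
    | comm i j h => simpa using hc i j h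
    | quad i => simpa using hq i⟩

/-- The index `i` of `H_m`, regarded as an index of `H_{m+1}`. -/
def Idx.up {m : ℕ} (i : Idx m) : Idx (m + 1) := ⟨i.1, i.2.1, Nat.lt_succ_of_lt i.2.2⟩

/-- The natural embedding `H_m → H_{m+1}`, `T_i ↦ T_i`. -/
def incl (m : ℕ) : Hecke m →ₐ[K] Hecke (m + 1) :=
  lift (fun i => gen i.up)
    (fun i j h => gen_braid i.up j.up h)
    (fun i j h => gen_comm i.up j.up h)
    (fun i => gen_quad i.up)

/-- The index `k + 1` of the last generator `T_{k+1}` of `H_{k+2}`. -/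
def lastIdx (k : ℕ) : Idx (k + 2) := ⟨k + 1, by omega, by omega⟩

/-- The Jucys–Murphy element `y_{k+1}` of `H_{k+1}`:
`y_1 = 1` and `y_{k+2} = T_{k+1} y_{k+1} T_{k+1}`. -/
def jucysMurphy : (k : ℕ) → Hecke (k + 1)
  | 0 => 1
  | k + 1 => gen (lastIdx k) * incl (k + 1) (jucysMurphy k) * gen (lastIdx k)

/-- The `q`-content `q^{2(j-i)}` of the cell in row `i` and column `j`
(the difference is the same whether rows and columns are numbered from `0` or from `1`). -/
def qContent (c : ℕ × ℕ) : K := q ^ (2 * ((c.2 : ℤ) - (c.1 : ℤ)))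

open Classical in
/-- The cells that are addable to the diagram `μ`; see `mem_addable`. -/
def addable (μ : YoungDiagram) : Finset (ℕ × ℕ) :=
  (Finset.range (μ.card + 1) ×ˢ Finset.range (μ.card + 1)).filter fun c =>
    c ∉ μ.cells ∧ IsLowerSet ((insert c μ.cells : Finset (ℕ × ℕ)) : Set (ℕ × ℕ))

theorem mem_addable (μ : YoungDiagram) (c : ℕ × ℕ) :
    c ∈ addable μ ↔
      c ∉ μ.cells ∧ IsLowerSet ((insert c μ.cells : Finset (ℕ × ℕ)) : Set (ℕ × ℕ)) := by
  classical
  obtain ⟨i, j⟩ := c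
  simp only [addable, Finset.mem_filter, Finset.mem_product, Finset.mem_range,
    and_iff_right_iff_imp]
  rintro ⟨-, h⟩
  have key : ∀ a b, a ≤ i → b ≤ j → (a, b) ≠ (i, j) → (a, b) ∈ μ.cells := by
    intro a b ha hb hne
    have := h (show (a, b) ≤ (i, j) from ⟨ha, hb⟩) (by simp)
    simp only [Finset.coe_insert, Set.mem_insert_iff] at this
    exact this.resolve_left hne
  constructor
  · have hs : (Finset.range i).image (fun a => (a, j)) ⊆ μ.cells := by
      intro x hx
      obtain ⟨a, ha, rfl⟩ := Finset.mem_image.1 hx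
      have ha := Finset.mem_range.1 ha
      exact key a j ha.le le_rfl (by simp; omega)
    have := Finset.card_le_card hs
    rw [Finset.card_image_of_injective _ (fun a b h => by simpa using h)] at this
    simp only [Finset.card_range] at this
    exact Nat.lt_succ_of_le this
  · have hs : (Finset.range j).image (fun b => (i, b)) ⊆ μ.cells := by
      intro x hx
      obtain ⟨b, hb, rfl⟩ := Finset.mem_image.1 hx
      have hb := Finset.mem_range.1 hb
      exact key i b le_rfl hb.le (by simp; omega)
    have := Finset.card_le_card hs
    rw [Finset.card_image_of_injective _ (fun a b h => by simpa using h)] at this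
    simp only [Finset.card_range] at this
    exact Nat.lt_succ_of_le this

/-- A standard tableau with `n` cells: a diagram together with a bijective filling of its cells
by the numbers `1, …, n` that increases along the rows and down the columns. The cell occupied
by the number `a + 1` is `cell a`, as a pair (row, column) numbered from `0`. -/
structure StandardTableau (n : ℕ) where
  shape : YoungDiagram
  cell : Fin n → ℕ × ℕ
  bijOn : Set.BijOn cell Set.univ (shape.cells : Set (ℕ × ℕ))
  row_lt : ∀ a b, (cell a).1 = (cell b).1 → (cell a).2 < (cell b).2 → a < b
  col_lt : ∀ a b, (cell a).2 = (cell b).2 → (cell a).1 < (cell b).1 → a < b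

/-- The tableau obtained from `T` by removing the cell occupied by the largest number. -/
def StandardTableau.removeLast {n : ℕ} (T : StandardTableau (n + 1)) : StandardTableau n where
  shape :=
    { cells := T.shape.cells.erase (T.cell (Fin.last n))
      isLowerSet := by
        intro y x hxy hy
        simp only [Finset.coe_erase, Set.mem_sdiff, Finset.mem_coe, Set.mem_singleton_iff] at hy ⊢
        refine ⟨T.shape.isLowerSet hxy hy.1, ?_⟩
        rintro rfl
        have hcorner : ((T.cell (Fin.last n)).1, y.2) ∈ T.shape.cells :=
          T.shape.isLowerSet (show ((T.cell (Fin.last n)).1, y.2) ≤ y from ⟨hxy.1, le_rfl⟩) hy.1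
        rcases lt_or_eq_of_le hxy.2 with h2 | h2
        · obtain ⟨b, -, hb⟩ := T.bijOn.surjOn hcorner
          have := T.row_lt (Fin.last n) b (by rw [hb]) (by rw [hb]; exact h2)
          exact absurd (Fin.le_last b) (not_le.2 this)
        · obtain ⟨b, -, hb⟩ := T.bijOn.surjOn hy.1
          have h1 : (T.cell (Fin.last n)).1 < y.1 := lt_of_le_of_ne hxy.1
            (fun h1 => hy.2 (Prod.ext h1.symm h2.symm))
          have := T.col_lt (Fin.last n) b (by rw [hb]; exact h2) (by rw [hb]; exact h1)
          exact absurd (Fin.le_last b) (not_le.2 this) }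
  cell := fun a => T.cell a.castSucc
  bijOn := by
    refine ⟨fun a _ => ?_, fun a _ b _ h => ?_, fun c hc => ?_⟩
    · simp only [Finset.coe_erase, Set.mem_sdiff, Finset.mem_coe, Set.mem_singleton_iff]
      refine ⟨T.bijOn.mapsTo (Set.mem_univ _), fun h => ?_⟩
      have := T.bijOn.injOn (Set.mem_univ _) (Set.mem_univ _) h
      exact (Fin.castSucc_lt_last a).ne this
    · exact Fin.castSucc_injective n (T.bijOn.injOn (Set.mem_univ _) (Set.mem_univ _) h)
    · simp only [Finset.coe_erase, Set.mem_sdiff, Finset.mem_coe, Set.mem_singleton_iff] at hc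
      obtain ⟨b, -, hb⟩ := T.bijOn.surjOn hc.1
      have hne : b ≠ Fin.last n := by
        rintro rfl
        exact hc.2 hb.symm
      exact ⟨b.castPred hne, Set.mem_univ _, by simpa using hb⟩
  row_lt := fun a b h1 h2 => T.row_lt _ _ h1 h2
  col_lt := fun a b h1 h2 => T.col_lt _ _ h1 h2

/-- The polynomial `∏ (X - ρ) / (σ - ρ)`, where `σ` is the `q`-content of the cell `α` and `ρ`
runs over the `q`-contents of the cells other than `α` that are addable to `μ`. -/
def contentPoly (μ : YoungDiagram) (α : ℕ × ℕ) : Polynomial K :=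
  ∏ c ∈ (addable μ).erase α,
    Polynomial.C (qContent α - qContent c)⁻¹ * (Polynomial.X - Polynomial.C (qContent c))

/-- The primitive idempotent `E_T` of `H_n`. With `U` the tableau obtained from `T` by removing
the cell `α` occupied by `n`, `E_T` is the product of `E_U` with the value of
`∏ (X - ρ) / (σ - ρ)` at `y_n`. (For `n = 1` this gives `E_T = 1`.) -/
def idempotent : (n : ℕ) → StandardTableau n → Hecke n
  | 0, _ => 1
  | n + 1, T =>
      incl n (idempotent n T.removeLast) *
        Polynomial.aeval (jucysMurphy n)
          (contentPoly T.removeLast.shape (T.cell (Fin.last n)))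

/-- The properties that determine the linear maps `Tr_{m+1} : H_{m+1} → H_m`
(here `Tr m` is `Tr_{m+1}`). The conditions that involve a generator `T_m` concern `m ≥ 1`,
and are written with `m = k + 1`. -/
structure IsPartialTrace (Q : K) (Tr : (m : ℕ) → Hecke (m + 1) →ₗ[K] Hecke m) : Prop where
  bimodule : ∀ (m : ℕ) (X Y : Hecke m) (Z : Hecke (m + 1)),
    Tr m (incl m X * Z * incl m Y) = X * Tr m Z * Y
  scalar : ∀ (m : ℕ) (X : Hecke m), Tr m (incl m X) = Q • X
  conj : ∀ (k : ℕ) (X : Hecke (k + 1)),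
    Tr (k + 1) (↑(genUnit (lastIdx k)) * incl (k + 1) X * ↑(genUnit (lastIdx k))⁻¹) =
      incl k (Tr k X)
  conj_inv : ∀ (k : ℕ) (X : Hecke (k + 1)),
    Tr (k + 1) (↑(genUnit (lastIdx k))⁻¹ * incl (k + 1) X * ↑(genUnit (lastIdx k))) =
      incl k (Tr k X)
  gen_last : ∀ k : ℕ, Tr (k + 1) (gen (lastIdx k)) = 1
  cyclic : ∀ (k : ℕ) (Z : Hecke (k + 2)),
    Tr k (Tr (k + 1) (gen (lastIdx k) * Z)) = Tr k (Tr (k + 1) (Z * gen (lastIdx k)))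

/-- `H_0` has no generators and is the ground field. -/
def zeroEquiv : Hecke 0 ≃ₐ[K] K :=
  AlgEquiv.ofAlgHom
    (lift (fun i => absurd i.2.2 (Nat.not_lt_zero _))
      (fun i => absurd i.2.2 (Nat.not_lt_zero _))
      (fun i => absurd i.2.2 (Nat.not_lt_zero _))
      (fun i => absurd i.2.2 (Nat.not_lt_zero _)))
    (Algebra.ofId K (Hecke 0))
    (by ext)
    (by
      apply RingQuot.ringQuot_ext'
      ext i
      exact absurd i.2.2 (Nat.not_lt_zero _))

/-- The composition `Tr_1 Tr_2 ⋯ Tr_n : H_n → ℂ(q)`; it is the Ocneanu–Markov trace when the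
maps `Tr_m` satisfy `IsPartialTrace`. -/
def totalTrace (Tr : (m : ℕ) → Hecke (m + 1) →ₗ[K] Hecke m) : (n : ℕ) → Hecke n →ₗ[K] K
  | 0 => zeroEquiv.toLinearMap
  | n + 1 => totalTrace Tr n ∘ₗ Tr n

end HeckeTrace

end

noncomputable section

namespace HeckeTrace

local notation "𝔷" => (q - q⁻¹ : K)

/-! Write z = q - q⁻¹. For existence of the partial traces, H_{m+1} is made to act on (H_m)^{m+1} by
the formulas that describe left multiplication by T_j on the products T_{i+1}⋯T_m with right
coefficients in H_m. The Hecke relations are checked directly on coordinates (`op_quad`,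
`op_comm_of_lt`, `op_braid`), so it is never needed that these products form a basis. Applying x to
the vector representing 1 and replacing T_{i+1}⋯T_m by T_{i+1}⋯T_{m-1}, and 1 by Q, defines the
trace of x. Uniqueness, conjugation and cyclicity are tested on H_{m+1} = H_m + H_m T_m H_m
(`induction_on_incl`).

For a tableau U of shape μ with n cells, let x_i be the q-content of the first free cell in row i.
The partial trace of y_{n+1}^k is a polynomial in y_1, …, y_n, and its value at the contents of U is
the moment ∑ w_i x_i^k, where z w_i x_i are the residues of an explicit rational function depending
only on μ and Q. Indeed both sides obey the same recurrence when a cell is added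
(`partialTrace_jucysMurphy_pow`, `moment_eq`). Since w_i vanishes where no cell can be added, and
the polynomial defining E_T from E_U vanishes at all addable cells except the new cell α, this gives
Tr(E_T) = w_α Tr(E_U).

Replacing the y_k by contents is justified under the trace only: Tr(E_T X) = x Tr(E_T) for a
polynomial X in the y_k with value x (`totalTrace_idempotent_mul`), proved along with the induction
instead of the eigenvalue equations y_k E_T = c_k E_T. The pairs (X, x) form a subalgebra `jmPairs`,
so evaluation need not be well defined as a map.

Finally w_α is a quotient of two values of one function of the row lengths
(`weight_mul_shapeTrace`), so the product of the weights along T telescopes and forgets T. -/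

/-! ### Generators, embeddings and the decomposition H_m + H_m T_m H_m -/

theorem adjoin_range_gen (n : ℕ) : Algebra.adjoin K (Set.range (gen : Idx n → Hecke n)) = ⊤ := by
  have h : Set.range (gen : Idx n → Hecke n) =
      RingQuot.mkAlgHom K (Rel n) '' Set.range (FreeAlgebra.ι K) := by
    rw [← Set.range_comp]; rfl
  rw [h, ← AlgHom.map_adjoin, FreeAlgebra.adjoin_range_ι, Algebra.map_top,
    AlgHom.range_eq_top]
  exact RingQuot.mkAlgHom_surjective K (Rel n)

/-- Replaces induction on words: with S cut out by a linear identity, the identity is proved by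
adding one generator on the left at a time. -/
theorem mem_of_gen_mul_mem {n : ℕ} {S : Submodule K (Hecke n)} (h1 : 1 ∈ S)
    (hg : ∀ i, ∀ x ∈ S, gen i * x ∈ S) (x : Hecke n) : x ∈ S := by
  have hx : x ∈ Algebra.adjoin K (Set.range (gen : Idx n → Hecke n)) := by
    rw [adjoin_range_gen]; trivial
  have key : ∀ y ∈ S, x * y ∈ S := by
    induction hx using Algebra.adjoin_induction with
    | mem x hx => obtain ⟨i, rfl⟩ := hx; exact hg i
    | algebraMap r => intro y hy; rw [← Algebra.smul_def]; exact S.smul_mem r hy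
    | add x y _ _ hx hy => intro w hw; rw [add_mul]; exact S.add_mem (hx w hw) (hy w hw)
    | mul x y _ _ hx hy => intro w hw; rw [mul_assoc]; exact hx _ (hy w hw)
  simpa using key 1 h1

theorem commute_map_of_commute_gen {n : ℕ} {A : Type*} [Ring A] [Algebra K A] (f : Hecke n →ₐ[K] A)
    {Z : A} (h : ∀ i, Commute Z (f (gen i))) (x : Hecke n) : Commute Z (f x) := by
  have hx : x ∈ Algebra.adjoin K (Set.range (gen : Idx n → Hecke n)) := by
    rw [adjoin_range_gen]; trivial
  induction hx using Algebra.adjoin_induction with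
  | mem x hx => obtain ⟨i, rfl⟩ := hx; exact h i
  | algebraMap r => rw [AlgHom.commutes]; exact (Algebra.commutes r Z).symm
  | add x y _ _ hx hy => rw [map_add]; exact hx.add_right hy
  | mul x y _ _ hx hy => rw [map_mul]; exact hx.mul_right hy

/-- The generator `T_j` of `H_n`, extended by `1` to all indices `j`. -/
def tgen (n j : ℕ) : Hecke n := if h : 1 ≤ j ∧ j < n then gen ⟨j, h⟩ else 1

theorem gen_eq_tgen {n : ℕ} (i : Idx n) : gen i = tgen n i.1 := by
  simp [tgen, i.2.1, i.2.2]

theorem gen_lastIdx (k : ℕ) : gen (lastIdx k) = tgen (k + 2) (k + 1) := gen_eq_tgen _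

theorem tgen_comm {n i j : ℕ} (h : i + 1 < j) : tgen n i * tgen n j = tgen n j * tgen n i := by
  unfold tgen
  split_ifs
  · exact gen_comm _ _ (Or.inl h)
  all_goals simp

theorem tgen_braid {n j : ℕ} (h1 : 1 ≤ j) (h2 : j + 1 < n) :
    tgen n j * tgen n (j + 1) * tgen n j = tgen n (j + 1) * tgen n j * tgen n (j + 1) := by
  rw [← gen_eq_tgen ⟨j, h1, by omega⟩, ← gen_eq_tgen ⟨j + 1, by omega, h2⟩]
  exact gen_braid _ _ rfl

theorem tgen_quad {n j : ℕ} (h1 : 1 ≤ j) (h2 : j < n) :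
    tgen n j * tgen n j = 1 + 𝔷 • tgen n j := by
  rw [← gen_eq_tgen ⟨j, h1, h2⟩]
  exact gen_quad _

theorem incl_gen {m : ℕ} (i : Idx m) : incl m (gen i) = gen i.up := by
  simp [incl, lift, gen]

theorem incl_tgen {m j : ℕ} (h : j < m) : incl m (tgen m j) = tgen (m + 1) j := by
  unfold tgen
  by_cases h1 : 1 ≤ j
  · rw [dif_pos ⟨h1, h⟩, dif_pos ⟨h1, by omega⟩, incl_gen]; rfl
  · rw [dif_neg (by omega), dif_neg (by omega), map_one]

/-- The generators of H_k have index at most k - 1, hence are distant from k + 1. -/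
theorem commute_tgen_incl_incl (k : ℕ) (x : Hecke k) :
    Commute (tgen (k + 2) (k + 1)) (incl (k + 1) (incl k x)) := by
  refine commute_map_of_commute_gen ((incl (k + 1)).comp (incl k)) (fun i => ?_) x
  have := i.2
  rw [AlgHom.comp_apply, gen_eq_tgen, incl_tgen i.2.2, incl_tgen (by omega)]
  exact (tgen_comm (by omega)).symm

theorem incl_zero_surjective (x : Hecke 1) : ∃ a, x = incl 0 a := by
  refine mem_of_gen_mul_mem (S := LinearMap.range (incl 0).toLinearMap) ⟨1, by simp⟩
    (fun i => absurd i.2 (by omega)) x |>.imp fun a h => h.symm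

/-- `H_{m+1}` is the sum of `H_m` and `H_m T_m H_m`. -/
theorem induction_on_incl {m : ℕ} {S : Submodule K (Hecke (m + 1))}
    (h1 : ∀ a, incl m a ∈ S)
    (h2 : 1 ≤ m → ∀ a b, incl m a * tgen (m + 1) m * incl m b ∈ S) (x : Hecke (m + 1)) :
    x ∈ S := by
  induction m with
  | zero => obtain ⟨a, rfl⟩ := incl_zero_surjective x; exact h1 a
  | succ m ih =>
    have h2 := h2 (by omega)
    let S' := Submodule.span K {Z : Hecke (m + 2) | (∃ a, Z = incl (m + 1) a) ∨
      ∃ a b, Z = incl (m + 1) a * tgen (m + 2) (m + 1) * incl (m + 1) b}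
    have g1 : ∀ a, incl (m + 1) a ∈ S' := fun a => Submodule.subset_span (Or.inl ⟨a, rfl⟩)
    have g2 : ∀ a b, incl (m + 1) a * tgen (m + 2) (m + 1) * incl (m + 1) b ∈ S' :=
      fun a b => Submodule.subset_span (Or.inr ⟨a, b, rfl⟩)
    have hle : S' ≤ S := by
      refine Submodule.span_le.2 ?_
      rintro _ (⟨a, rfl⟩ | ⟨a, b, rfl⟩)
      exacts [h1 a, h2 a b]
    -- The only product not visibly in the span has two factors T_{m+1}. By induction a lies in H_m,
    -- and the quadratic relation applies, or in H_m T_m H_m, and the braid relation leaves a single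
    -- T_{m+1}.
    have key : ∀ a b, tgen (m + 2) (m + 1) * incl (m + 1) a * tgen (m + 2) (m + 1) *
        incl (m + 1) b ∈ S' := by
      intro a b
      refine ih (S := S'.comap (LinearMap.mulRight K (incl (m + 1) b) ∘ₗ
        LinearMap.mulRight K (tgen (m + 2) (m + 1)) ∘ₗ
        LinearMap.mulLeft K (tgen (m + 2) (m + 1)) ∘ₗ (incl (m + 1)).toLinearMap)) ?_ ?_ a
      · intro a
        have e : tgen (m + 2) (m + 1) * incl (m + 1) (incl m a) * tgen (m + 2) (m + 1) *
            incl (m + 1) b = incl (m + 1) (incl m a * b) +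
            𝔷 • (incl (m + 1) (incl m a) * tgen (m + 2) (m + 1) * incl (m + 1) b) := by
          rw [(commute_tgen_incl_incl m a).eq, mul_assoc (incl _ _),
            tgen_quad (by omega) (by omega)]
          simp [mul_add, add_mul]
        have := S'.add_mem (g1 (incl m a * b)) (S'.smul_mem 𝔷 (g2 (incl m a) b))
        rw [← e] at this
        exact this
      · intro hm c d
        have e : tgen (m + 2) (m + 1) * incl (m + 1) (incl m c * tgen (m + 1) m * incl m d) *
            tgen (m + 2) (m + 1) * incl (m + 1) b =
            incl (m + 1) (incl m c * tgen (m + 1) m) * tgen (m + 2) (m + 1) *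
              incl (m + 1) (tgen (m + 1) m * incl m d * b) := by
          simp only [map_mul, incl_tgen (Nat.lt_succ_self m)]
          have hc := (commute_tgen_incl_incl m c).eq
          have hd := (commute_tgen_incl_incl m d).eq
          have hb := tgen_braid (n := m + 2) hm (by omega)
          calc _ = (tgen (m + 2) (m + 1) * incl (m + 1) (incl m c)) * tgen (m + 2) m *
                (incl (m + 1) (incl m d) * tgen (m + 2) (m + 1)) * incl (m + 1) b := by
                simp only [mul_assoc]
            _ = incl (m + 1) (incl m c) * (tgen (m + 2) (m + 1) * tgen (m + 2) m *
                tgen (m + 2) (m + 1)) * incl (m + 1) (incl m d) * incl (m + 1) b := by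
                rw [hc, ← hd]; simp only [mul_assoc]
            _ = _ := by rw [← hb]; simp only [mul_assoc]
        have := g2 (incl m c * tgen (m + 1) m) (tgen (m + 1) m * incl m d * b)
        rw [← e] at this
        exact this
    refine hle (mem_of_gen_mul_mem (by simpa using g1 1) (fun i x hx => ?_) x)
    rcases Nat.lt_or_ge i.1 (m + 1) with hi | hi
    · rw [gen_eq_tgen, ← incl_tgen hi]
      induction hx using Submodule.span_induction with
      | mem x hx =>
        rcases hx with ⟨a, rfl⟩ | ⟨a, b, rfl⟩
        · rw [← map_mul]; exact g1 _
        · rw [← mul_assoc, ← mul_assoc, ← map_mul]; exact g2 _ _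
      | zero => simp
      | add x y _ _ hx hy => rw [mul_add]; exact S'.add_mem hx hy
      | smul r x _ hx => rw [mul_smul_comm]; exact S'.smul_mem r hx
    · have hi' : i.1 = m + 1 := by have := i.2.2; omega
      rw [gen_eq_tgen, hi']
      induction hx using Submodule.span_induction with
      | mem x hx =>
        rcases hx with ⟨a, rfl⟩ | ⟨a, b, rfl⟩
        · simpa using g2 1 a
        · simpa only [mul_assoc] using key a b
      | zero => simp
      | add x y _ _ hx hy => rw [mul_add]; exact S'.add_mem hx hy
      | smul r x _ hx => rw [mul_smul_comm]; exact S'.smul_mem r hx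

/-! ### The left action of H_{m+1} in coordinates over H_m -/

/-- The action of `T_j` on `H_{m+1} = ⨁ T_{i+1} ⋯ T_m H_m`, in coordinates. -/
def op (m : ℕ) (j : Idx (m + 1)) : Module.End K (Fin (m + 1) → Hecke m) where
  toFun f i :=
    if j.1 < i.1 then tgen m j * f i
    else if i.1 = j.1 then f ⟨j.1 - 1, by omega⟩
    else if i.1 + 1 = j.1 then f ⟨j.1, j.2.2⟩ + 𝔷 • f i
    else tgen m (j.1 - 1) * f i
  map_add' f g := by
    ext i
    simp only [Pi.add_apply]
    split_ifs
    all_goals simp only [mul_add, smul_add]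
    abel
  map_smul' r f := by
    ext i
    simp only [Pi.smul_apply, RingHom.id_apply]
    split_ifs <;> simp only [mul_smul_comm, smul_add, smul_comm r]

section
variable {m : ℕ} (j : Idx (m + 1)) (f : Fin (m + 1) → Hecke m) (i : Fin (m + 1))

theorem op_of_lt (h : j.1 < i.1) : op m j f i = tgen m j * f i := if_pos h

theorem op_of_eq (h : i.1 = j.1) : op m j f i = f ⟨j.1 - 1, by omega⟩ :=
  (if_neg (by omega)).trans (if_pos h)

theorem op_of_succ_eq (h : i.1 + 1 = j.1) :
    op m j f i = f ⟨j.1, j.2.2⟩ + 𝔷 • f i :=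
  (if_neg (by omega)).trans ((if_neg (by omega)).trans (if_pos h))

theorem op_of_succ_lt (h : i.1 + 1 < j.1) : op m j f i = tgen m (j.1 - 1) * f i :=
  (if_neg (by omega)).trans ((if_neg (by omega)).trans (if_neg (by omega)))

end

/-- T_j mixes only the coordinates j - 1 and j, through the matrix with rows (z, 1) and (1, 0),
which satisfies the quadratic relation. Elsewhere it is left multiplication by a generator of H_m.
-/
theorem op_quad {m : ℕ} (j : Idx (m + 1)) : op m j * op m j = 1 + 𝔷 • op m j := by
  refine LinearMap.ext fun f => funext fun i => ?_
  have := j.2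
  simp only [Module.End.mul_apply, LinearMap.add_apply, Module.End.one_apply,
    LinearMap.smul_apply, Pi.add_apply, Pi.smul_apply]
  rcases lt_trichotomy j.1 i.1 with h | h | h
  · rw [op_of_lt _ _ _ h, op_of_lt _ _ _ h, ← mul_assoc, tgen_quad (by omega) (by omega)]
    simp [add_mul]
  · rw [op_of_eq _ _ _ h.symm, op_of_eq _ _ _ h.symm, op_of_succ_eq _ _ _ (by simp; omega)]
    congr 2
    exact Fin.ext h
  · rcases Nat.lt_or_ge (i.1 + 1) j.1 with h' | h'
    · rw [op_of_succ_lt _ _ _ h', op_of_succ_lt _ _ _ h', ← mul_assoc,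
        tgen_quad (by omega) (by omega)]
      simp [add_mul]
    · rw [op_of_succ_eq _ _ i (by omega), op_of_succ_eq _ _ i (by omega),
        op_of_eq _ _ ⟨j.1, _⟩ rfl]
      congr 2
      exact Fin.ext (by simp; omega)

theorem op_comm_of_lt {m : ℕ} (a b : Idx (m + 1)) (hab : a.1 + 1 < b.1) :
    op m a * op m b = op m b * op m a := by
  refine LinearMap.ext fun f => funext fun i => ?_
  have ha := a.2
  have hb := b.2
  simp only [Module.End.mul_apply]
  rcases lt_trichotomy b.1 i.1 with h | h | h
  · rw [op_of_lt a _ _ (by omega), op_of_lt b _ _ h, op_of_lt b _ _ h, op_of_lt a _ _ (by omega),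
      ← mul_assoc, ← mul_assoc, tgen_comm hab]
  · rw [op_of_lt a _ _ (by omega), op_of_eq b _ _ h.symm, op_of_eq b _ _ h.symm,
      op_of_lt a _ _ (by simp; omega)]
  rcases lt_trichotomy (i.1 + 1) b.1 with h1 | h1 | h1
  · rw [op_of_succ_lt b _ i h1]
    rcases lt_trichotomy a.1 i.1 with h2 | h2 | h2
    · rw [op_of_lt a _ _ h2, op_of_lt a _ _ h2, op_of_succ_lt b _ i h1, ← mul_assoc, ← mul_assoc,
        tgen_comm (by omega)]
    · rw [op_of_eq a _ _ h2.symm, op_of_eq a _ _ h2.symm, op_of_succ_lt b _ _ (by simp; omega)]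
    rcases lt_trichotomy (i.1 + 1) a.1 with h3 | h3 | h3
    · rw [op_of_succ_lt a _ i h3, op_of_succ_lt a _ i h3, op_of_succ_lt b _ i h1,
        ← mul_assoc, ← mul_assoc, tgen_comm (by omega)]
    · rw [op_of_succ_eq a _ i h3, op_of_succ_eq a _ i h3, op_of_succ_lt b _ i h1,
        op_of_succ_lt b _ _ (by simp; omega)]
      simp [mul_add]
    · omega
  · rw [op_of_succ_eq b _ i h1, op_of_lt a (op m b f) i (by omega), op_of_lt a f i (by omega),
      op_of_succ_eq b f i h1, op_of_lt a f ⟨b.1, hb.2⟩ (show a.1 < b.1 by omega)]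
    simp [mul_add]
  · omega

/-- Outside three consecutive coordinates both operators are left multiplications by adjacent
generators of H_m, with indices lowered by one below the window. Inside the window the relation is a
direct computation. -/
theorem op_braid {m : ℕ} (a b : Idx (m + 1)) (hab : b.1 = a.1 + 1) :
    op m a * op m b * op m a = op m b * op m a * op m b := by
  refine LinearMap.ext fun f => funext fun i => ?_
  obtain ⟨a, ha⟩ := a
  obtain ⟨b, hb⟩ := b
  obtain ⟨i, hi⟩ := i
  obtain rfl : b = a + 1 := hab
  -- With the two generators numbered a + 1 and a + 2, the exceptional coordinates are a, a + 1 and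
  -- a + 2.
  obtain ⟨a, rfl⟩ : ∃ c, a = c + 1 := ⟨a - 1, by omega⟩
  simp only [Module.End.mul_apply]
  have hA2 (g) : op m ⟨a + 1, ha⟩ g ⟨a + 1 + 1, hb.2⟩ = tgen m (a + 1) * g ⟨a + 1 + 1, hb.2⟩ :=
    op_of_lt _ _ _ (by simp)
  have hA1 (g) : op m ⟨a + 1, ha⟩ g ⟨a + 1, ha.2⟩ = g ⟨a, by omega⟩ := op_of_eq _ _ _ rfl
  have hA0 (g) : op m ⟨a + 1, ha⟩ g ⟨a, by omega⟩ = g ⟨a + 1, ha.2⟩ + 𝔷 • g ⟨a, by omega⟩ :=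
    op_of_succ_eq _ _ _ rfl
  have hB2 (g) : op m ⟨a + 1 + 1, hb⟩ g ⟨a + 1 + 1, hb.2⟩ = g ⟨a + 1, ha.2⟩ := op_of_eq _ _ _ rfl
  have hB1 (g) : op m ⟨a + 1 + 1, hb⟩ g ⟨a + 1, ha.2⟩ =
      g ⟨a + 1 + 1, hb.2⟩ + 𝔷 • g ⟨a + 1, ha.2⟩ := op_of_succ_eq _ _ _ rfl
  have hB0 (g) : op m ⟨a + 1 + 1, hb⟩ g ⟨a, by omega⟩ = tgen m (a + 1) * g ⟨a, by omega⟩ :=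
    op_of_succ_lt _ _ _ (by simp)
  rcases lt_trichotomy (a + 1 + 1) i with h | h | h
  · rw [op_of_lt _ _ _ (by simp; omega), op_of_lt _ _ _ (by simp; omega),
      op_of_lt _ _ _ (by simp; omega), op_of_lt _ _ _ (by simp; omega),
      op_of_lt _ _ _ (by simp; omega), op_of_lt _ _ _ (by simp; omega)]
    simp only [← mul_assoc]
    rw [tgen_braid (by omega) (by omega)]
  · subst h
    simp only [hA2, hA1, hB2, hB0]
  rcases lt_trichotomy (a + 1) i with h1 | h1 | h1
  · omega
  · subst h1
    simp only [hA2, hA1, hA0, hB2, hB1, hB0, mul_add, mul_smul_comm]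
  rcases lt_trichotomy a i with h2 | h2 | h2
  · omega
  · subst h2
    simp only [hA2, hA1, hA0, hB1, hB0, mul_add, mul_smul_comm, smul_add]
    rw [← mul_assoc (tgen m (a + 1)) (tgen m (a + 1)), tgen_quad (by omega) (by omega)]
    simp only [add_mul, one_mul, smul_mul_assoc, smul_add]
    abel
  · obtain ⟨a, rfl⟩ : ∃ c, a = c + 1 := ⟨a - 1, by omega⟩
    rw [op_of_succ_lt _ _ _ (by simp; omega), op_of_succ_lt _ _ _ (by simp; omega),
      op_of_succ_lt _ _ _ (by simp; omega), op_of_succ_lt _ _ _ (by simp; omega),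
      op_of_succ_lt _ _ _ (by simp; omega), op_of_succ_lt _ _ _ (by simp; omega)]
    simp only [← mul_assoc, add_tsub_cancel_right]
    rw [tgen_braid (by omega) (by omega)]

/-- The action of `H_{m+1}` on itself, in coordinates. -/
def rep (m : ℕ) : Hecke (m + 1) →ₐ[K] Module.End K (Fin (m + 1) → Hecke m) :=
  lift (op m) op_braid
    (fun i j h => h.elim (op_comm_of_lt i j) (fun h => (op_comm_of_lt j i h).symm)) op_quad

theorem rep_gen {m : ℕ} (j : Idx (m + 1)) : rep m (gen j) = op m j := by
  simp [rep, lift, gen]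

/-! ### Construction of the partial traces -/

/-- The product `T_{m-d} ⋯ T_{m-1}`. -/
def chain (m : ℕ) : ℕ → Hecke m
  | 0 => 1
  | d + 1 => tgen m (m - (d + 1)) * chain m d

theorem tgen_mul_chain_of_lt {m j : ℕ} : ∀ {d : ℕ}, j + d + 1 < m →
    tgen m j * chain m d = chain m d * tgen m j
  | 0, _ => by simp [chain]
  | d + 1, h => by
    rw [chain, ← mul_assoc, tgen_comm (by omega), mul_assoc, tgen_mul_chain_of_lt (by omega),
      mul_assoc]

/-- Sliding T_j through T_{m-d}⋯T_{m-1}: it commutes until it meets T_{j-1} T_j, where the braid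
relation turns it into T_{j-1}, which commutes with all that follows. -/
theorem tgen_mul_chain_of_gt {m j : ℕ} (h1 : 2 ≤ j) (hj : j < m) : ∀ {d : ℕ}, d < m → m < j + d →
    tgen m j * chain m d = chain m d * tgen m (j - 1)
  | 0, _, h => by omega
  | d + 1, hd, h => by
    rcases Nat.lt_or_ge m (j + d) with h' | h'
    · rw [chain, ← mul_assoc, ← tgen_comm (i := m - (d + 1)) (j := j) (by omega), mul_assoc,
        tgen_mul_chain_of_gt h1 hj (by omega) h', mul_assoc]
    · obtain ⟨d, rfl⟩ : ∃ e, d = e + 1 := ⟨d - 1, by omega⟩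
      obtain ⟨j, rfl⟩ : ∃ e, j = e + 1 := ⟨j - 1, by omega⟩
      have e1 : m - (d + 1 + 1) = j := by omega
      have e2 : m - (d + 1) = j + 1 := by omega
      have h3 : tgen m j * chain m d = chain m d * tgen m j :=
        tgen_mul_chain_of_lt (by omega)
      rw [chain, chain, e1, e2, add_tsub_cancel_right, ← mul_assoc, ← mul_assoc,
        ← tgen_braid (by omega) (by omega)]
      simp only [mul_assoc, h3]

/-- The partial trace of the basis element `T_{i+1} ⋯ T_m`. -/
def chainTrace (Q : K) (m i : ℕ) : Hecke m :=
  if i = m then algebraMap K _ Q else chain m (m - 1 - i)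

/-- The partial trace of `∑ T_{i+1} ⋯ T_m f_i`. -/
def coordTrace (Q : K) (m : ℕ) : (Fin (m + 1) → Hecke m) →ₗ[K] Hecke m where
  toFun f := ∑ i : Fin (m + 1), chainTrace Q m i * f i
  map_add' f g := by simp [mul_add, Finset.sum_add_distrib]
  map_smul' r f := by simp [Finset.smul_sum]

theorem coordTrace_single (Q : K) (m : ℕ) (i : Fin (m + 1)) (x : Hecke m) :
    coordTrace Q m (Pi.single i x) = chainTrace Q m i * x := by
  simp only [coordTrace, LinearMap.coe_mk, AddHom.coe_mk]
  rw [Finset.sum_eq_single i] <;> simp +contextual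

section
variable {m : ℕ} (j : Idx (m + 1)) (i : Fin (m + 1)) (x : Hecke m)

theorem op_single_of_lt (h : j.1 < i.1) :
    op m j (Pi.single i x) = Pi.single i (tgen m j * x) := by
  funext k
  simp only [op, LinearMap.coe_mk, AddHom.coe_mk, Pi.single_apply, Fin.ext_iff]
  split_ifs <;> first | omega | simp

theorem op_single_of_eq (h : i.1 = j.1) :
    op m j (Pi.single i x) = Pi.single ⟨j.1 - 1, by omega⟩ x := by
  funext k
  have := j.2
  simp only [op, LinearMap.coe_mk, AddHom.coe_mk, Pi.single_apply, Fin.ext_iff]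
  split_ifs <;> first | omega | simp

theorem op_single_of_succ_eq (h : i.1 + 1 = j.1) :
    op m j (Pi.single i x) = Pi.single (M := fun _ => Hecke m) ⟨j.1, j.2.2⟩ x +
        𝔷 • Pi.single (M := fun _ => Hecke m) i x := by
  funext k
  have := j.2
  simp only [op, LinearMap.coe_mk, AddHom.coe_mk, Pi.single_apply, Fin.ext_iff, Pi.add_apply,
    Pi.smul_apply]
  split_ifs <;> first | omega | simp

theorem op_single_of_succ_lt (h : i.1 + 1 < j.1) :
    op m j (Pi.single i x) = Pi.single i (tgen m (j - 1) * x) := by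
  funext k
  simp only [op, LinearMap.coe_mk, AddHom.coe_mk, Pi.single_apply, Fin.ext_iff]
  split_ifs <;> first | omega | simp

end

/-- Left H_m-linearity on generators. Coordinates away from j use the commutation of T_j with the
chain or its sliding through it; coordinates j - 1 and j use that prepending T_j lengthens the
chain, and the quadratic relation. -/
theorem coordTrace_op (Q : K) {m : ℕ} (j : Idx (m + 1)) (hj : j.1 < m)
    (f : Fin (m + 1) → Hecke m) : coordTrace Q m (op m j f) = tgen m j * coordTrace Q m f := by
  suffices h : coordTrace Q m ∘ₗ op m j = LinearMap.mulLeft K (tgen m j) ∘ₗ coordTrace Q m from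
    LinearMap.congr_fun h f
  refine LinearMap.pi_ext fun i x => ?_
  have hj1 := j.2
  have hi := i.2
  simp only [LinearMap.comp_apply, LinearMap.mulLeft_apply, coordTrace_single]
  have hc : ∀ i, i + 1 = j.1 → chainTrace Q m i = tgen m j * chainTrace Q m j := by
    intro i h
    have e : m - 1 - i = m - 1 - j.1 + 1 := by omega
    rw [chainTrace, if_neg (by omega), chainTrace, if_neg (by omega), e, chain]
    congr 2
    omega
  rcases lt_trichotomy j.1 i.1 with h | h | h
  · rw [op_single_of_lt _ _ _ h, coordTrace_single, ← mul_assoc, ← mul_assoc]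
    congr 1
    unfold chainTrace
    split_ifs with h2
    · exact Algebra.commutes _ _
    · exact (tgen_mul_chain_of_lt (by omega)).symm
  · rw [op_single_of_eq _ _ _ h.symm, coordTrace_single, ← mul_assoc,
      hc _ (by simp; omega), h]
  rcases Nat.lt_or_ge (i.1 + 1) j.1 with h' | h'
  · rw [op_single_of_succ_lt _ _ _ h', coordTrace_single, ← mul_assoc, ← mul_assoc]
    congr 1
    rw [chainTrace, if_neg (by omega), tgen_mul_chain_of_gt (by omega) hj (by omega) (by omega)]
  · rw [op_single_of_succ_eq _ _ _ (by omega), map_add, map_smul, coordTrace_single,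
      coordTrace_single, ← mul_assoc, hc i (by omega), ← mul_assoc, tgen_quad (by omega) hj]
    simp only [add_mul, one_mul, smul_mul_assoc]

theorem coordTrace_rep_incl (Q : K) {m : ℕ} (a : Hecke m) (f : Fin (m + 1) → Hecke m) :
    coordTrace Q m (rep m (incl m a) f) = a * coordTrace Q m f := by
  revert f
  let S : Submodule K (Hecke m) :=
    { carrier := {a | ∀ f, coordTrace Q m (rep m (incl m a) f) = a * coordTrace Q m f}
      add_mem' := fun ha hb f => by simp [add_mul, ha f, hb f]
      zero_mem' := fun f => by simp
      smul_mem' := fun r a ha f => by simp [ha f] }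
  refine mem_of_gen_mul_mem (S := S) (fun f => by simp) (fun i a ha f => ?_) a
  rw [map_mul, map_mul, Module.End.mul_apply, incl_gen, rep_gen, coordTrace_op Q _ i.2.2, ha f,
    ← mul_assoc, gen_eq_tgen]
  rfl

/-- The last basis vector stands for 1, and every generator of H_m has index below m, so it acts
there by plain left multiplication. -/
theorem rep_incl_single {m : ℕ} (a x : Hecke m) :
    rep m (incl m a) (Pi.single (Fin.last m) x) = Pi.single (Fin.last m) (a * x) := by
  revert x
  let S : Submodule K (Hecke m) :=
    { carrier := {a | ∀ x : Hecke m, rep m (incl m a) (Pi.single (Fin.last m) x) =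
        Pi.single (Fin.last m) (a * x)}
      add_mem' := fun ha hb f => by simp [add_mul, ha f, hb f, Pi.single_add]
      zero_mem' := fun f => by simp
      smul_mem' := fun r a ha f => by simp [ha f, Pi.single_smul] }
  refine mem_of_gen_mul_mem (S := S) (fun f => by simp) (fun i a ha x => ?_) a
  rw [map_mul, map_mul, Module.End.mul_apply, ha x, incl_gen, rep_gen,
    op_single_of_lt _ _ _ i.2.2, ← mul_assoc, gen_eq_tgen]
  rfl

/-- The operators multiply coordinates by elements of H_m on the left only, so they are right
H_m-linear. -/
theorem rep_mul_right {m : ℕ} (x : Hecke (m + 1)) (f : Fin (m + 1) → Hecke m) (b : Hecke m) :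
    rep m x (fun i => f i * b) = fun i => rep m x f i * b := by
  revert f
  let S : Submodule K (Hecke (m + 1)) :=
    { carrier := {x | ∀ f : Fin (m + 1) → Hecke m,
        rep m x (fun i => f i * b) = fun i => rep m x f i * b}
      add_mem' := fun ha hb f => by ext1 i; simp [add_mul, ha f, hb f]
      zero_mem' := fun f => by ext1 i; simp
      smul_mem' := fun r a ha f => by ext1 i; simp [ha f] }
  refine mem_of_gen_mul_mem (S := S) (fun f => by simp) (fun j x hx f => ?_) x
  rw [map_mul, Module.End.mul_apply, hx f, rep_gen]
  ext1 i
  simp only [Module.End.mul_apply, op, LinearMap.coe_mk, AddHom.coe_mk]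
  split_ifs <;> simp [mul_assoc, add_mul]

/-- The partial trace `Tr_{m+1}`. -/
def partialTrace (Q : K) (m : ℕ) : Hecke (m + 1) →ₗ[K] Hecke m :=
  coordTrace Q m ∘ₗ (LinearMap.applyₗ (Pi.single (Fin.last m) (1 : Hecke m))) ∘ₗ
    (rep m).toLinearMap

theorem partialTrace_apply (Q : K) (m : ℕ) (x : Hecke (m + 1)) :
    partialTrace Q m x = coordTrace Q m (rep m x (Pi.single (Fin.last m) 1)) := rfl

theorem partialTrace_bimodule (Q : K) (m : ℕ) (a b : Hecke m) (x : Hecke (m + 1)) :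
    partialTrace Q m (incl m a * x * incl m b) = a * partialTrace Q m x * b := by
  have h : (Pi.single (Fin.last m) (b * 1) : Fin (m + 1) → Hecke m) =
      fun i => (Pi.single (Fin.last m) 1 : Fin (m + 1) → Hecke m) i * b := by
    funext i
    simp only [Pi.single_apply]
    split_ifs <;> simp
  rw [partialTrace_apply, map_mul, map_mul, Module.End.mul_apply, Module.End.mul_apply,
    coordTrace_rep_incl, rep_incl_single, h, rep_mul_right, partialTrace_apply, mul_assoc]
  congr 1
  simp [coordTrace, Finset.sum_mul, mul_assoc]

theorem partialTrace_incl (Q : K) (m : ℕ) (a : Hecke m) :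
    partialTrace Q m (incl m a) = Q • a := by
  rw [partialTrace_apply, rep_incl_single, coordTrace_single]
  simp [chainTrace, Algebra.smul_def]

theorem partialTrace_tgen (Q : K) {m : ℕ} (hm : 1 ≤ m) :
    partialTrace Q m (tgen (m + 1) m) = 1 := by
  rw [partialTrace_apply, ← gen_eq_tgen ⟨m, hm, by omega⟩, rep_gen,
    op_single_of_eq _ _ _ rfl, coordTrace_single, chainTrace, if_neg (by simp; omega)]
  simp [chain]

/-! ### Uniqueness, conjugation invariance and cyclicity -/

theorem genUnit_lastIdx (k : ℕ) : (↑(genUnit (lastIdx k)) : Hecke (k + 2)) =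
    tgen (k + 2) (k + 1) := gen_lastIdx k

theorem genUnit_lastIdx_inv (k : ℕ) : (↑(genUnit (lastIdx k))⁻¹ : Hecke (k + 2)) =
    tgen (k + 2) (k + 1) - 𝔷 • 1 := by
  rw [← gen_lastIdx]; rfl

/-- Two linear maps on `H_{m+1}` agree if they agree on `H_m` and on `H_m T_m H_m`. -/
theorem linearMap_ext_incl {m : ℕ} {M : Type*} [AddCommGroup M] [Module K M]
    {f g : Hecke (m + 1) →ₗ[K] M} (h1 : ∀ a, f (incl m a) = g (incl m a))
    (h2 : 1 ≤ m → ∀ a b, f (incl m a * tgen (m + 1) m * incl m b) =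
      g (incl m a * tgen (m + 1) m * incl m b)) : f = g :=
  LinearMap.ext fun x => induction_on_incl (S := LinearMap.eqLocus f g) h1 h2 x

section
variable {Q : K} {m : ℕ} {Tr : Hecke (m + 1) →ₗ[K] Hecke m}
  (hb : ∀ (a b : Hecke m) (x : Hecke (m + 1)), Tr (incl m a * x * incl m b) = a * Tr x * b)
  (hs : ∀ a : Hecke m, Tr (incl m a) = Q • a)
  (hg : 1 ≤ m → Tr (tgen (m + 1) m) = 1)
include hb

theorem trace_incl_mul (a : Hecke m) (x : Hecke (m + 1)) : Tr (incl m a * x) = a * Tr x := by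
  simpa using hb a 1 x

theorem trace_mul_incl (b : Hecke m) (x : Hecke (m + 1)) : Tr (x * incl m b) = Tr x * b := by
  simpa using hb 1 b x

include hs hg

/-- The bimodule property with the values on H_m and at T_m fixes the map on H_m + H_m T_m H_m;
conjugation and cyclicity play no part in uniqueness. -/
theorem eq_of_bimodule {Tr' : Hecke (m + 1) →ₗ[K] Hecke m}
    (hb' : ∀ (a b : Hecke m) (x : Hecke (m + 1)), Tr' (incl m a * x * incl m b) = a * Tr' x * b)
    (hs' : ∀ a : Hecke m, Tr' (incl m a) = Q • a)
    (hg' : 1 ≤ m → Tr' (tgen (m + 1) m) = 1) : Tr = Tr' :=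
  linearMap_ext_incl (fun a => by rw [hs, hs']) (fun hm a b => by rw [hb, hb', hg hm, hg' hm])

end

/-- For X in H_k conjugation does nothing. For X in H_k T_k H_k the braid relation gives t s t⁻¹ =
s⁻¹ t s and t⁻¹ s t = s t s⁻¹, with s = T_k and t = T_{k+1}; the trace replaces t by 1 and s⁻¹ s
cancels. -/
theorem partialTrace_conj_aux (Q : K) (k : ℕ) (X : Hecke (k + 1)) :
    partialTrace Q (k + 1) (tgen (k + 2) (k + 1) * incl (k + 1) X *
      (tgen (k + 2) (k + 1) - 𝔷 • 1)) = incl k (partialTrace Q k X) ∧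
    partialTrace Q (k + 1) ((tgen (k + 2) (k + 1) - 𝔷 • 1) * incl (k + 1) X *
      tgen (k + 2) (k + 1)) = incl k (partialTrace Q k X) := by
  set t := tgen (k + 2) (k + 1) with ht
  have htt : t * t = 1 + 𝔷 • t := tgen_quad (by omega) (by omega)
  have e1 : t * (t - 𝔷 • 1) = 1 := by simp [mul_sub, htt]
  have e2 : (t - 𝔷 • 1) * t = 1 := by simp [sub_mul, htt]
  have hc (x : Hecke k) : t * incl (k + 1) (incl k x) = incl (k + 1) (incl k x) * t :=
    commute_tgen_incl_incl k x
  have hc' (x : Hecke k) : (t - 𝔷 • 1) * incl (k + 1) (incl k x) =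
      incl (k + 1) (incl k x) * (t - 𝔷 • 1) := by
    simp [mul_sub, sub_mul, hc]
  let S : Submodule K (Hecke (k + 1)) := LinearMap.eqLocus
    (partialTrace Q (k + 1) ∘ₗ LinearMap.mulRight K (t - 𝔷 • 1) ∘ₗ LinearMap.mulLeft K t ∘ₗ
      (incl (k + 1)).toLinearMap) ((incl k).toLinearMap ∘ₗ partialTrace Q k) ⊓
    LinearMap.eqLocus
    (partialTrace Q (k + 1) ∘ₗ LinearMap.mulRight K t ∘ₗ LinearMap.mulLeft K (t - 𝔷 • 1) ∘ₗ
      (incl (k + 1)).toLinearMap) ((incl k).toLinearMap ∘ₗ partialTrace Q k)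
  refine induction_on_incl (S := S) (fun a => ?_) (fun hk a b => ?_) X
  · constructor
    · change partialTrace Q (k + 1) (t * incl (k + 1) (incl k a) * (t - 𝔷 • 1)) =
        incl k (partialTrace Q k (incl k a))
      rw [hc, mul_assoc, e1, mul_one, partialTrace_incl, partialTrace_incl, map_smul]
    · change partialTrace Q (k + 1) ((t - 𝔷 • 1) * incl (k + 1) (incl k a) * t) =
        incl k (partialTrace Q k (incl k a))
      rw [hc', mul_assoc, e2, mul_one, partialTrace_incl, partialTrace_incl, map_smul]
  · set s := tgen (k + 1) k with hs
    have his : incl (k + 1) s = tgen (k + 2) k := incl_tgen (by omega)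
    have hss : s * s = 1 + 𝔷 • s := tgen_quad (by omega) (by omega)
    have hbr : incl (k + 1) s * t * incl (k + 1) s = t * incl (k + 1) s * t := by
      rw [his]; exact tgen_braid hk (by omega)
    have f1 : (s - 𝔷 • 1) * s = 1 := by simp [sub_mul, hss]
    have f2 : s * (s - 𝔷 • 1) = 1 := by simp [mul_sub, hss]
    have g1 : t * incl (k + 1) s * (t - 𝔷 • 1) =
        incl (k + 1) (s - 𝔷 • 1) * t * incl (k + 1) s := by
      simp [mul_sub, sub_mul, hbr]
    have g2 : (t - 𝔷 • 1) * incl (k + 1) s * t =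
        incl (k + 1) s * t * incl (k + 1) (s - 𝔷 • 1) := by
      simp [mul_sub, sub_mul, hbr]
    have hT : partialTrace Q (k + 1) t = 1 := partialTrace_tgen Q (by omega)
    have hT' : partialTrace Q k s = 1 := partialTrace_tgen Q hk
    constructor
    · change partialTrace Q (k + 1) (t * incl (k + 1) (incl k a * s * incl k b) * (t - 𝔷 • 1)) =
        incl k (partialTrace Q k (incl k a * s * incl k b))
      have : t * incl (k + 1) (incl k a * s * incl k b) * (t - 𝔷 • 1) =
          incl (k + 1) (incl k a * (s - 𝔷 • 1)) * t * incl (k + 1) (s * incl k b) := by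
        calc _ = (t * incl (k + 1) (incl k a)) * incl (k + 1) s *
              (incl (k + 1) (incl k b) * (t - 𝔷 • 1)) := by simp only [map_mul, mul_assoc]
          _ = incl (k + 1) (incl k a) * (t * incl (k + 1) s * (t - 𝔷 • 1)) *
              incl (k + 1) (incl k b) := by rw [hc, ← hc']; simp only [mul_assoc]
          _ = _ := by rw [g1]; simp only [map_mul, mul_assoc]
      rw [this, partialTrace_bimodule, partialTrace_bimodule, hT, hT', mul_one, mul_one,
        mul_assoc, ← mul_assoc _ s, f1, one_mul, map_mul]
    · change partialTrace Q (k + 1) ((t - 𝔷 • 1) * incl (k + 1) (incl k a * s * incl k b) * t) =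
        incl k (partialTrace Q k (incl k a * s * incl k b))
      have : (t - 𝔷 • 1) * incl (k + 1) (incl k a * s * incl k b) * t =
          incl (k + 1) (incl k a * s) * t * incl (k + 1) ((s - 𝔷 • 1) * incl k b) := by
        calc _ = ((t - 𝔷 • 1) * incl (k + 1) (incl k a)) * incl (k + 1) s *
              (incl (k + 1) (incl k b) * t) := by simp only [map_mul, mul_assoc]
          _ = incl (k + 1) (incl k a) * ((t - 𝔷 • 1) * incl (k + 1) s * t) *
              incl (k + 1) (incl k b) := by rw [hc', ← hc]; simp only [mul_assoc]
          _ = _ := by rw [g2]; simp only [map_mul, mul_assoc]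
      rw [this, partialTrace_bimodule, partialTrace_bimodule, hT, hT', mul_one, mul_one,
        mul_assoc, ← mul_assoc s, f2, one_mul, map_mul]

/-- The partial trace of `T_{k+1} a T_{k+1}` for `a ∈ H_k`. -/
theorem partialTrace_sandwich_incl (Q : K) (k : ℕ) (a : Hecke k) :
    partialTrace Q (k + 1) (tgen (k + 2) (k + 1) * incl (k + 1) (incl k a) *
      tgen (k + 2) (k + 1)) = (Q + 𝔷) • incl k a := by
  rw [(commute_tgen_incl_incl k a).eq, mul_assoc, tgen_quad (by omega) (by omega),
    trace_incl_mul (partialTrace_bimodule Q (k + 1)), map_add, map_smul,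
    partialTrace_tgen Q (by omega), ← map_one (incl (k + 1)), partialTrace_incl, ← add_smul,
    mul_smul_comm, mul_one]

theorem partialTrace_sandwich_tgen (Q : K) {k : ℕ} (hk : 1 ≤ k) (a b : Hecke k) :
    partialTrace Q (k + 1) (tgen (k + 2) (k + 1) *
      incl (k + 1) (incl k a * tgen (k + 1) k * incl k b) * tgen (k + 2) (k + 1)) =
      incl k a * (1 + 𝔷 • tgen (k + 1) k) * incl k b := by
  set t := tgen (k + 2) (k + 1) with ht
  have hc (x : Hecke k) : t * incl (k + 1) (incl k x) = incl (k + 1) (incl k x) * t :=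
    commute_tgen_incl_incl k x
  have hbr : t * tgen (k + 2) k * t = tgen (k + 2) k * t * tgen (k + 2) k :=
    (tgen_braid hk (by omega)).symm
  rw [← incl_tgen (by omega)] at hbr
  have : t * incl (k + 1) (incl k a * tgen (k + 1) k * incl k b) * t =
      incl (k + 1) (incl k a * tgen (k + 1) k) * t * incl (k + 1) (tgen (k + 1) k * incl k b) := by
    calc _ = (t * incl (k + 1) (incl k a)) * incl (k + 1) (tgen (k + 1) k) *
          (incl (k + 1) (incl k b) * t) := by simp only [map_mul, mul_assoc]
      _ = incl (k + 1) (incl k a) * (t * incl (k + 1) (tgen (k + 1) k) * t) *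
          incl (k + 1) (incl k b) := by rw [hc a, ← hc b]; simp only [mul_assoc]
      _ = _ := by rw [hbr]; simp only [map_mul, mul_assoc]
  rw [this, partialTrace_bimodule, partialTrace_tgen Q (by omega), mul_one, mul_assoc,
    ← mul_assoc (tgen _ _), tgen_quad hk (by omega), ← mul_assoc]

/-- The map F(x) = Tr(t x t) is self-adjoint for the pairing (a, b) ↦ Tr(ab). It multiplies H_k by Q
+ z and sends x T_k y to x(1 + z T_k)y, so both sides agree when a and b run over H_k and H_k T_k
H_k. -/
theorem partialTrace_cyclic_aux (Q : K) (k : ℕ) (a b : Hecke (k + 1)) :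
    partialTrace Q k (partialTrace Q (k + 1)
      (tgen (k + 2) (k + 1) * incl (k + 1) a * tgen (k + 2) (k + 1)) * b) =
    partialTrace Q k (a * partialTrace Q (k + 1)
      (tgen (k + 2) (k + 1) * incl (k + 1) b * tgen (k + 2) (k + 1))) := by
  set t := tgen (k + 2) (k + 1) with ht
  let F : Hecke (k + 1) →ₗ[K] Hecke (k + 1) := partialTrace Q (k + 1) ∘ₗ
    LinearMap.mulRight K t ∘ₗ LinearMap.mulLeft K t ∘ₗ (incl (k + 1)).toLinearMap
  have hF1 (x) : F (incl k x) = (Q + 𝔷) • incl k x := partialTrace_sandwich_incl Q k x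
  have hF2 (hk : 1 ≤ k) (x y) : F (incl k x * tgen (k + 1) k * incl k y) =
      incl k x * (1 + 𝔷 • tgen (k + 1) k) * incl k y := partialTrace_sandwich_tgen Q hk x y
  change partialTrace Q k (F a * b) = partialTrace Q k (a * F b)
  revert b
  suffices h : partialTrace Q k ∘ₗ LinearMap.mulLeft K (F a) =
      partialTrace Q k ∘ₗ LinearMap.mulLeft K a ∘ₗ F from fun b => LinearMap.congr_fun h b
  have hquad (hk : 1 ≤ k) : partialTrace Q k (1 + 𝔷 • tgen (k + 1) k) = Q • 1 + 𝔷 • 1 := by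
    rw [map_add, map_smul, partialTrace_tgen Q hk, ← map_one (incl k), partialTrace_incl]
  have hbm := partialTrace_bimodule Q k
  refine linearMap_ext_incl (fun b => ?_) (fun hk b b' => ?_)
  · change partialTrace Q k (F a * incl k b) = partialTrace Q k (a * F (incl k b))
    rw [hF1, trace_mul_incl hbm, mul_smul_comm, map_smul, trace_mul_incl hbm, ← smul_mul_assoc,
      ← map_smul]
    congr 1
    suffices h : partialTrace Q k ∘ₗ F = partialTrace Q k ∘ₗ ((Q + 𝔷) • LinearMap.id) from
      LinearMap.congr_fun h a
    refine linearMap_ext_incl (fun c => ?_) (fun hk c d => ?_)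
    · change partialTrace Q k (F (incl k c)) = partialTrace Q k ((Q + 𝔷) • incl k c)
      rw [hF1]
    · change partialTrace Q k (F _) =
        partialTrace Q k ((Q + 𝔷) • (incl k c * tgen (k + 1) k * incl k d))
      rw [hF2 hk, map_smul, hbm, hbm, hquad hk, partialTrace_tgen Q hk, ← add_smul]
      simp
  · change partialTrace Q k (F a * (incl k b * tgen (k + 1) k * incl k b')) =
      partialTrace Q k (a * F (incl k b * tgen (k + 1) k * incl k b'))
    rw [hF2 hk, ← mul_assoc, ← mul_assoc, ← mul_assoc, ← mul_assoc, trace_mul_incl hbm,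
      trace_mul_incl hbm]
    congr 1
    suffices h : partialTrace Q k ∘ₗ LinearMap.mulRight K (incl k b * tgen (k + 1) k) ∘ₗ F =
        partialTrace Q k ∘ₗ LinearMap.mulRight K (incl k b * (1 + 𝔷 • tgen (k + 1) k)) by
      simpa [mul_assoc] using LinearMap.congr_fun h a
    refine linearMap_ext_incl (fun c => ?_) (fun hk c d => ?_)
    · change partialTrace Q k (F (incl k c) * (incl k b * tgen (k + 1) k)) =
        partialTrace Q k (incl k c * (incl k b * (1 + 𝔷 • tgen (k + 1) k)))
      rw [hF1, smul_mul_assoc, map_smul, ← mul_assoc, ← mul_assoc, ← map_mul,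
        trace_incl_mul hbm, trace_incl_mul hbm, hquad hk, partialTrace_tgen Q hk, ← add_smul]
      simp
    · change partialTrace Q k (F (incl k c * tgen (k + 1) k * incl k d) *
          (incl k b * tgen (k + 1) k)) =
        partialTrace Q k (incl k c * tgen (k + 1) k * incl k d *
          (incl k b * (1 + 𝔷 • tgen (k + 1) k)))
      have e1 : partialTrace Q k (incl k c * (incl k d * (incl k b * tgen (k + 1) k))) =
          c * (d * b) := by
        rw [← mul_assoc (incl k d), ← mul_assoc, ← map_mul, ← map_mul, trace_incl_mul hbm,
          partialTrace_tgen Q hk, mul_one]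
      have e2 : partialTrace Q k (incl k c * (tgen (k + 1) k * (incl k d * incl k b))) =
          c * (d * b) := by
        rw [← map_mul, ← mul_assoc, hbm, partialTrace_tgen Q hk, mul_one]
      rw [hF2 hk]
      simp only [mul_add, add_mul, mul_one, mul_smul_comm, smul_mul_assoc, map_add, map_smul,
        mul_assoc, e1, e2]

/-- On H_{k+1} already the inner traces agree. On a t b, the bimodule property reduces the claim to
the self-adjointness of x ↦ Tr(t x t). -/
theorem partialTrace_cyclic (Q : K) (k : ℕ) (Z : Hecke (k + 2)) :
    partialTrace Q k (partialTrace Q (k + 1) (tgen (k + 2) (k + 1) * Z)) =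
      partialTrace Q k (partialTrace Q (k + 1) (Z * tgen (k + 2) (k + 1))) := by
  set t := tgen (k + 2) (k + 1) with ht
  suffices h : partialTrace Q k ∘ₗ partialTrace Q (k + 1) ∘ₗ LinearMap.mulLeft K t =
      partialTrace Q k ∘ₗ partialTrace Q (k + 1) ∘ₗ LinearMap.mulRight K t from
    LinearMap.congr_fun h Z
  have hbm := partialTrace_bimodule Q (k + 1)
  refine linearMap_ext_incl (fun a => ?_) (fun _ a b => ?_)
  · change partialTrace Q k (partialTrace Q (k + 1) (t * incl (k + 1) a)) =
      partialTrace Q k (partialTrace Q (k + 1) (incl (k + 1) a * t))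
    rw [trace_mul_incl hbm, trace_incl_mul hbm, partialTrace_tgen Q (by omega), one_mul, mul_one]
  · change partialTrace Q k (partialTrace Q (k + 1) (t * (incl (k + 1) a * t * incl (k + 1) b))) =
      partialTrace Q k (partialTrace Q (k + 1) (incl (k + 1) a * t * incl (k + 1) b * t))
    rw [← mul_assoc, ← mul_assoc, trace_mul_incl hbm, mul_assoc (incl (k + 1) a), mul_assoc (incl (k + 1) a),
      trace_incl_mul hbm]
    exact partialTrace_cyclic_aux Q k a b

theorem isPartialTrace_partialTrace (Q : K) : IsPartialTrace Q (partialTrace Q) where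
  bimodule m := partialTrace_bimodule Q m
  scalar := partialTrace_incl Q
  conj k X := by
    rw [genUnit_lastIdx, genUnit_lastIdx_inv]
    exact (partialTrace_conj_aux Q k X).1
  conj_inv k X := by
    rw [genUnit_lastIdx, genUnit_lastIdx_inv]
    exact (partialTrace_conj_aux Q k X).2
  gen_last k := by rw [gen_lastIdx]; exact partialTrace_tgen Q (by omega)
  cyclic k Z := by rw [gen_lastIdx]; exact partialTrace_cyclic Q k Z

theorem IsPartialTrace.eq_partialTrace {Q : K} {Tr : (m : ℕ) → Hecke (m + 1) →ₗ[K] Hecke m}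
    (h : IsPartialTrace Q Tr) : Tr = partialTrace Q := by
  funext m
  refine eq_of_bimodule (h.bimodule m) (h.scalar m) (fun hm => ?_) (partialTrace_bimodule Q m)
    (partialTrace_incl Q m) (partialTrace_tgen Q)
  obtain ⟨k, rfl⟩ : ∃ k, m = k + 1 := ⟨m - 1, by omega⟩
  rw [← gen_lastIdx, h.gen_last]

/-! ### Partial fractions, weights and moments -/

open Polynomial in
/-- Partial fraction expansion at infinity of a quotient of monic polynomials of equal degree. -/
theorem eval_div_prod_sub {F ι : Type*} [Field F] [DecidableEq ι] {s : Finset ι} {v : ι → F}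
    (hv : Set.InjOn v s) {P : F[X]} (hP : P.Monic) (hd : P.natDegree = s.card) {x : F}
    (hx : ∀ i ∈ s, x ≠ v i) :
    P.eval x / ∏ i ∈ s, (x - v i) =
      1 + ∑ i ∈ s, P.eval (v i) / ((x - v i) * ∏ j ∈ s.erase i, (v i - v j)) := by
  -- Subtracting the monic nodal polynomial lowers the degree, so the difference equals its Lagrange
  -- interpolant at the nodes.
  have hdeg : (P - Lagrange.nodal s v).degree < s.card := by
    rw [← hd, ← degree_eq_natDegree hP.ne_zero]
    refine degree_sub_lt_left ?_ hP.ne_zero (by rw [hP, Lagrange.nodal_monic])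
    rw [Lagrange.degree_nodal, degree_eq_natDegree hP.ne_zero, hd]
  have h := congrArg (eval x) (Lagrange.eq_interpolate hv hdeg)
  rw [Lagrange.eval_interpolate_not_at_node _ hx, eval_sub, Lagrange.eval_nodal] at h
  have h0 : ∏ i ∈ s, (x - v i) ≠ 0 := Finset.prod_ne_zero_iff.2 fun i hi => sub_ne_zero.2 (hx i hi)
  rw [div_eq_iff h0, add_mul, one_mul, mul_comm (∑ i ∈ s, _), eq_add_of_sub_eq' h]
  congr 2
  refine Finset.sum_congr rfl fun i hi => ?_
  rw [eval_sub, Lagrange.eval_nodal_at_node hi, sub_zero, Lagrange.nodalWeight,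
    Finset.prod_inv_distrib, div_eq_mul_inv, mul_inv]
  ring

theorem q_ne_zero : q ≠ 0 := RatFunc.X_ne_zero

theorem q_pow_eq_one {n : ℕ} (h : q ^ n = 1) : n = 0 := by
  have h1 : (Polynomial.X ^ n : Polynomial ℂ) = 1 := by
    apply RatFunc.algebraMap_injective ℂ
    rw [map_pow, map_one, RatFunc.algebraMap_X]
    exact h
  simpa using congrArg Polynomial.natDegree h1

theorem q_zpow_injective : Function.Injective fun a : ℤ => q ^ a := by
  have key (a : ℤ) (h : q ^ a = 1) : a = 0 := by
    obtain ⟨n, rfl | rfl⟩ := a.eq_nat_or_neg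
    · rw [zpow_natCast] at h
      rw [q_pow_eq_one h]; rfl
    · rw [zpow_neg, zpow_natCast, inv_eq_one] at h
      rw [q_pow_eq_one h]; rfl
  intro a b h
  have := key (a - b) (by rw [zpow_sub₀ q_ne_zero]; exact (div_eq_one_iff_eq (zpow_ne_zero _ q_ne_zero)).2 h)
  omega

theorem q_sq_ne_one : q ^ 2 ≠ 1 := fun h => by simpa using q_pow_eq_one h

theorem z_ne_zero : 𝔷 ≠ 0 := by
  intro h
  apply q_sq_ne_one
  have := q_ne_zero
  field_simp at h
  linear_combination h

/-- The `q`-content of the first cell to the right of row `i`, for row lengths `l`. -/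
def node (l : ℕ → ℕ) (i : ℕ) : K := q ^ (2 * ((l i : ℤ) - i))

theorem node_ne_zero (l : ℕ → ℕ) (i : ℕ) : node l i ≠ 0 := zpow_ne_zero _ q_ne_zero

/-- The exponents l i - i strictly decrease, and q is not a root of unity. -/
theorem node_injective {l : ℕ → ℕ} (hl : Antitone l) : Function.Injective (node l) := by
  intro i j h
  have h := q_zpow_injective h
  rcases lt_trichotomy i j with hij | hij | hij
  · have := hl hij.le; omega
  · exact hij
  · have := hl hij.le; omega

theorem node_congr {l l' : ℕ → ℕ} {i : ℕ} (h : l' i = l i) : node l' i = node l i := by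
  rw [node, h, node]

theorem node_succ {l l' : ℕ → ℕ} {i : ℕ} (h : l' i = l i + 1) : node l' i = q ^ 2 * node l i := by
  rw [node, h, node, ← zpow_natCast, ← zpow_add₀ q_ne_zero]
  congr 1
  push_cast
  ring

/-- The numerator of the generating function of the moments of the Jucys–Murphy element. -/
def numer (Q : K) (N : ℕ) (l : ℕ → ℕ) : Polynomial K :=
  (Polynomial.X - Polynomial.C (1 - 𝔷 * Q)) *
    ∏ j ∈ Finset.range N, (Polynomial.X - Polynomial.C ((q ^ 2)⁻¹ * node l j))

theorem eval_numer (Q : K) (N : ℕ) (l : ℕ → ℕ) (x : K) : (numer Q N l).eval x =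
    (x - (1 - 𝔷 * Q)) * ∏ j ∈ Finset.range N, (x - (q ^ 2)⁻¹ * node l j) := by
  simp [numer, Polynomial.eval_prod]

theorem numer_monic (Q : K) (N : ℕ) (l : ℕ → ℕ) : (numer Q N l).Monic :=
  (Polynomial.monic_X_sub_C _).mul
    (Polynomial.monic_prod_of_monic _ _ fun _ _ => Polynomial.monic_X_sub_C _)

theorem natDegree_numer (Q : K) (N : ℕ) (l : ℕ → ℕ) : (numer Q N l).natDegree = N + 1 := by
  rw [numer, (Polynomial.monic_X_sub_C _).natDegree_mul
    (Polynomial.monic_prod_of_monic _ _ fun _ _ => Polynomial.monic_X_sub_C _),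
    Polynomial.natDegree_prod_of_monic _ _ fun _ _ => Polynomial.monic_X_sub_C _]
  simp only [Polynomial.natDegree_X_sub_C, Finset.sum_const, Finset.card_range, smul_eq_mul, mul_one]
  exact add_comm 1 N

/-- The trace of `E_T` is `weight` times the trace of `E_U`, where `T` is obtained from the tableau
`U` with row lengths `l` by adding a cell in row `i`. -/
def weight (Q : K) (N : ℕ) (l : ℕ → ℕ) (i : ℕ) : K :=
  (numer Q N l).eval (node l i) /
    (𝔷 * node l i * ∏ j ∈ (Finset.range (N + 1)).erase i, (node l i - node l j))

/-- The weights are normalized residues: expanded in 1/x, the right side is 1 + z ∑ m_{k+1} x^{-k-1}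
with m_k the moments. -/
theorem eval_numer_div {Q : K} {N : ℕ} {l : ℕ → ℕ} (hl : Antitone l) {x : K}
    (hx : ∀ i, x ≠ node l i) :
    (numer Q N l).eval x / ∏ i ∈ Finset.range (N + 1), (x - node l i) =
      1 + 𝔷 * ∑ i ∈ Finset.range (N + 1), weight Q N l i * node l i / (x - node l i) := by
  rw [eval_div_prod_sub (node_injective hl).injOn (numer_monic Q N l)
    (by rw [natDegree_numer, Finset.card_range]) (fun i _ => hx i), Finset.mul_sum]
  congr 1
  refine Finset.sum_congr rfl fun i _ => ?_
  have h1 : ∏ j ∈ (Finset.range (N + 1)).erase i, (node l i - node l j) ≠ 0 :=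
    Finset.prod_ne_zero_iff.2 fun j hj =>
      sub_ne_zero.2 fun h => (Finset.mem_erase.1 hj).1 (node_injective hl h).symm
  have h2 := node_ne_zero l i
  have h3 := z_ne_zero
  have h4 := sub_ne_zero.2 (hx i)
  rw [weight]
  generalize (q - q⁻¹ : K) = z at h3 ⊢
  field_simp

/-- Comparison at x = 0. The factors q⁻² in the numerator multiply to q^{-2N}, which is the node of
the empty row N, so the quotient is 1 - zQ. -/
theorem sum_weight {Q : K} {N : ℕ} {l : ℕ → ℕ} (hl : Antitone l) (hN : l N = 0) :
    ∑ i ∈ Finset.range (N + 1), weight Q N l i = Q := by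
  have h := eval_numer_div (Q := Q) (N := N) hl (x := 0) fun i => (node_ne_zero l i).symm
  have e : ∑ i ∈ Finset.range (N + 1), weight Q N l i * node l i / (0 - node l i) =
      -∑ i ∈ Finset.range (N + 1), weight Q N l i := by
    rw [← Finset.sum_neg_distrib]
    refine Finset.sum_congr rfl fun i _ => ?_
    have := node_ne_zero l i
    field_simp
    simp
  have hq : node l N = (q ^ 2)⁻¹ ^ N := by
    rw [node, hN, ← zpow_natCast, ← zpow_natCast, ← zpow_neg, ← zpow_mul]
    congr 1
    push_cast
    ring
  have h0 : ∏ i ∈ Finset.range N, (0 - node l i) ≠ 0 :=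
    Finset.prod_ne_zero_iff.2 fun j _ => by simpa using node_ne_zero l j
  have e2 : ∏ j ∈ Finset.range N, (0 - (q ^ 2)⁻¹ * node l j) =
      node l N * ∏ i ∈ Finset.range N, (0 - node l i) := by
    rw [hq, ← Finset.card_range N, ← Finset.prod_const, Finset.card_range,
      ← Finset.prod_mul_distrib]
    exact Finset.prod_congr rfl fun _ _ => by ring
  have h1 := node_ne_zero l N
  rw [e, eval_numer, e2, Finset.prod_range_succ, div_eq_iff (mul_ne_zero h0 (by simpa using h1))] at h
  have h3 : ((1 - 𝔷 * Q) - (1 - 𝔷 * ∑ i ∈ Finset.range (N + 1), weight Q N l i)) *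
      (node l N * ∏ i ∈ Finset.range N, (0 - node l i)) = 0 := by
    linear_combination -h
  rcases mul_eq_zero.1 h3 with h3 | h3
  · refine mul_left_cancel₀ z_ne_zero ?_
    linear_combination h3
  · exact absurd h3 (mul_ne_zero h1 h0)

/-- When two consecutive rows are equal, the lower node is q⁻² times the upper one, hence a root of
the numerator: rows that cannot be extended carry no weight. -/
theorem weight_eq_zero {Q : K} {N : ℕ} {l : ℕ → ℕ} {i : ℕ} (hi : i < N) (h : l (i + 1) = l i) :
    weight Q N l (i + 1) = 0 := by
  rw [weight, eval_numer, Finset.prod_eq_zero (Finset.mem_range.2 hi), mul_zero, zero_div]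
  rw [sub_eq_zero, node, node, h, ← zpow_natCast, ← zpow_neg, ← zpow_add₀ q_ne_zero]
  congr 1
  push_cast
  ring

/-- The moments `∑ w_i x_i ^ k` of the measure with weights `w_i` at the nodes `x_i`. -/
def moment (Q : K) (N : ℕ) (l : ℕ → ℕ) (k : ℕ) : K :=
  ∑ i ∈ Finset.range (N + 1), weight Q N l i * node l i ^ k

theorem moment_zero_shape (Q : K) (N k : ℕ) : moment Q N 0 k = Q := by
  have h (k : ℕ) : moment Q N 0 k = weight Q N 0 0 := by
    rw [moment, Finset.sum_range_succ', Finset.sum_eq_zero]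
    · simp [node]
    · intro i hi
      rw [weight_eq_zero (Finset.mem_range.1 hi) rfl, zero_mul]
  rw [h, ← h 0]
  simpa [moment] using sum_weight (Q := Q) (N := N) (l := 0) antitone_const rfl

/-! ### Change of weights and moments when a cell is added -/

section
variable {Q : K} {N : ℕ} {l l' : ℕ → ℕ} {a : ℕ} (hl : Antitone l) (hl' : Antitone l')
  (hN : l N = 0) (ha : a < N) (hne : ∀ i, i ≠ a → l' i = l i) (hla : l' a = l a + 1)

include hl hne hla in
theorem node_ne_node_of_add (i : ℕ) : node l a ≠ node l' i := by
  rcases eq_or_ne i a with rfl | hi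
  · rw [node_succ hla]
    intro h
    refine q_sq_ne_one (mul_right_cancel₀ (node_ne_zero l i) ?_)
    rw [← h, one_mul]
  · rw [node_congr (hne i hi)]
    exact fun h => hi (node_injective hl h).symm

-- Only the factors at row a change. With c the content of the new cell, x - q⁻²c becomes x - c in
-- the numerator and x - c becomes x - q²c in the denominator.
include hl hl' ha hne hla in
theorem weight_of_ne {i : ℕ} (hi : i ≠ a) : weight Q N l i = weight Q N l' i *
    (1 - 𝔷 ^ 2 * (node l a * node l' i / (node l' i - node l a) ^ 2)) := by
  have e1 : ∏ j ∈ (Finset.range N).erase a, (node l i - (q ^ 2)⁻¹ * node l' j) =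
      ∏ j ∈ (Finset.range N).erase a, (node l i - (q ^ 2)⁻¹ * node l j) :=
    Finset.prod_congr rfl fun j hj => by rw [node_congr (hne j (Finset.mem_erase.1 hj).1)]
  have e2 : ∏ j ∈ ((Finset.range (N + 1)).erase i).erase a, (node l i - node l' j) =
      ∏ j ∈ ((Finset.range (N + 1)).erase i).erase a, (node l i - node l j) :=
    Finset.prod_congr rfl fun j hj => by rw [node_congr (hne j (Finset.mem_erase.1 hj).1)]
  have ha' : a ∈ (Finset.range (N + 1)).erase i :=
    Finset.mem_erase.2 ⟨hi.symm, Finset.mem_range.2 (by omega)⟩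
  have n1 : node l i - node l a ≠ 0 := sub_ne_zero.2 fun h => hi (node_injective hl h)
  have n2 : node l i - q ^ 2 * node l a ≠ 0 := by
    rw [← node_congr (hne i hi), ← node_succ hla]
    exact sub_ne_zero.2 fun h => hi (node_injective hl' h)
  have n3 : ∏ j ∈ ((Finset.range (N + 1)).erase i).erase a, (node l i - node l j) ≠ 0 :=
    Finset.prod_ne_zero_iff.2 fun j hj => sub_ne_zero.2 fun h =>
      (Finset.mem_erase.1 (Finset.mem_erase.1 hj).2).1 (node_injective hl h).symm
  have n4 := node_ne_zero l i
  have n5 := z_ne_zero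
  have n6 := q_ne_zero
  rw [weight, weight, node_congr (hne i hi), eval_numer, eval_numer,
    ← Finset.mul_prod_erase _ _ ha', ← Finset.mul_prod_erase _ _ ha',
    ← Finset.mul_prod_erase _ _ (Finset.mem_range.2 ha),
    ← Finset.mul_prod_erase _ _ (Finset.mem_range.2 ha), e1, e2, node_succ hla]
  generalize ∏ j ∈ ((Finset.range (N + 1)).erase i).erase a, (node l i - node l j) = D at *
  generalize ∏ j ∈ (Finset.range N).erase a, (node l i - (q ^ 2)⁻¹ * node l j) = B
  generalize node l i = x at *
  generalize node l a = c at *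
  have e3 : (1 - 𝔷 ^ 2 * (c * x / (x - c) ^ 2)) =
      (x - q ^ 2 * c) * (x - (q ^ 2)⁻¹ * c) / (x - c) ^ 2 := by
    field_simp
    ring
  have e4 : (q ^ 2)⁻¹ * (q ^ 2 * c) = c := by field_simp
  rw [e3, e4]
  generalize x - (q ^ 2)⁻¹ * c = y
  generalize x - q ^ 2 * c = y' at *
  generalize (q - q⁻¹ : K) = z at *
  field_simp

-- The recurrences are solved by t_k = z ∑ w'_i x'_i^{k+1}/(x'_i - c) and s_k = z ∑ w'_i c x'_i
-- (x'_i^k - c^k)/(x'_i - c)², where primes refer to the larger diagram. The change of weights then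
-- gives the difference of the moments.
include hl hl' hN ha hne hla in
theorem moment_eq {s t : ℕ → K} (ht0 : t 0 = 1) (hs0 : s 0 = 0)
    (ht : ∀ k, t (k + 1) = node l a * t k + 𝔷 * moment Q N l' (k + 1))
    (hs : ∀ k, s (k + 1) = node l a * (s k + t k)) (k : ℕ) :
    moment Q N l' k = moment Q N l k + 𝔷 * s k := by
  have hN' : l' N = 0 := by rw [hne N ha.ne', hN]
  have hc := node_ne_node_of_add hl hne hla
  set c := node l a with hcdef
  have hd (i) : node l' i - c ≠ 0 := sub_ne_zero.2 (hc i).symm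
  -- The initial value t_0 = 1 is the partial fraction identity at x = c, a root of the new
  -- numerator because the new node in row a is q²c.
  have T0 : 𝔷 * ∑ i ∈ Finset.range (N + 1), weight Q N l' i * (node l' i / (node l' i - c)) = 1 := by
    have h := eval_numer_div (Q := Q) (N := N) hl' hc
    rw [eval_numer, Finset.prod_eq_zero (Finset.mem_range.2 ha), mul_zero, zero_div] at h
    · have e : ∑ i ∈ Finset.range (N + 1), weight Q N l' i * (node l' i / (node l' i - c)) =
        -∑ i ∈ Finset.range (N + 1), weight Q N l' i * node l' i / (c - node l' i) := by
        rw [← Finset.sum_neg_distrib]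
        refine Finset.sum_congr rfl fun i _ => ?_
        rw [← div_neg, neg_sub, mul_div_assoc]
      rw [e]
      linear_combination h
    · rw [node_succ hla, ← mul_assoc, inv_mul_cancel₀ (pow_ne_zero 2 q_ne_zero), one_mul, sub_self]
  have Ht (k) : t k = 𝔷 * ∑ i ∈ Finset.range (N + 1),
      weight Q N l' i * (node l' i ^ (k + 1) / (node l' i - c)) := by
    induction k with
    | zero => simpa [ht0] using T0.symm
    | succ k ih =>
      rw [ht, ih, moment, mul_left_comm, ← mul_add, Finset.mul_sum, ← Finset.sum_add_distrib]
      congr 1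
      refine Finset.sum_congr rfl fun i _ => ?_
      have := hd i
      field_simp
      ring
  have Hs (k) : s k = 𝔷 * ∑ i ∈ Finset.range (N + 1),
      weight Q N l' i * (c * node l' i * (node l' i ^ k - c ^ k) / (node l' i - c) ^ 2) := by
    induction k with
    | zero => simp [hs0]
    | succ k ih =>
      rw [hs, ih, Ht, ← mul_add, mul_left_comm, ← Finset.sum_add_distrib, Finset.mul_sum]
      congr 1
      refine Finset.sum_congr rfl fun i _ => ?_
      have := hd i
      field_simp
      ring
  have Hm (k) : moment Q N l k = weight Q N l a * c ^ k + ∑ i ∈ Finset.range (N + 1),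
      weight Q N l' i * (1 - 𝔷 ^ 2 * (c * node l' i / (node l' i - c) ^ 2)) * node l' i ^ k := by
    have ha' : a ∈ Finset.range (N + 1) := Finset.mem_range.2 (by omega)
    rw [moment, ← Finset.add_sum_erase _ _ ha', ← Finset.add_sum_erase (a := a) _ _ ha']
    -- At x'_a = q²c the factor vanishes, so the term i = a may be included in the sum over the new
    -- weights; the old weight at a is carried separately.
    have e0 : 1 - 𝔷 ^ 2 * (c * node l' a / (node l' a - c) ^ 2) = 0 := by
      have h1 := node_ne_zero l a
      have h2 := q_ne_zero
      have h3 : q ^ 2 - 1 ≠ 0 := sub_ne_zero.2 q_sq_ne_one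
      have h4 : node l' a - c = (q ^ 2 - 1) * c := by rw [node_succ hla]; ring
      rw [h4, node_succ hla, ← hcdef]
      rw [← hcdef] at h1
      field_simp
      ring
    rw [e0, mul_zero, zero_mul, zero_add]
    congr 1
    refine Finset.sum_congr rfl fun i hi => ?_
    have hi := (Finset.mem_erase.1 hi).1
    rw [weight_of_ne hl hl' ha hne hla hi, node_congr (hne i hi)]
  -- The one weight not covered by `weight_of_ne` is found from the total mass, which is Q for both
  -- diagrams.
  have h0 : weight Q N l a = 𝔷 ^ 2 * ∑ i ∈ Finset.range (N + 1),
      weight Q N l' i * (c * node l' i / (node l' i - c) ^ 2) := by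
    have h := Hm 0
    have e1 : moment Q N l 0 = ∑ i ∈ Finset.range (N + 1), weight Q N l' i := by
      rw [sum_weight hl' hN']
      simpa [moment] using sum_weight (Q := Q) hl hN
    rw [e1] at h
    simp only [pow_zero, mul_one, mul_sub, Finset.sum_sub_distrib] at h
    rw [Finset.mul_sum]
    simp only [mul_left_comm (𝔷 ^ 2)]
    linear_combination -h
  rw [Hm, h0, Hs, moment, Finset.mul_sum, Finset.sum_mul, Finset.mul_sum, Finset.mul_sum,
    ← Finset.sum_add_distrib, ← Finset.sum_add_distrib]
  refine Finset.sum_congr rfl fun i _ => ?_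
  ring

end

/-! ### The product formula for the trace -/

/-- Effect on a Vandermonde product of changing one variable, cross-multiplied to avoid division;
the order of the differences is immaterial, as signs agree on the two sides. -/
theorem prod_prod_sub_update {F : Type*} [CommRing F] {v v' : ℕ → F} {a : ℕ}
    (h : ∀ j, j ≠ a → v' j = v j) : ∀ {M : ℕ}, a < M →
    (∏ j ∈ Finset.range M, ∏ k ∈ Finset.range j, (v' k - v' j)) *
        ∏ j ∈ (Finset.range M).erase a, (v a - v j) =
      (∏ j ∈ Finset.range M, ∏ k ∈ Finset.range j, (v k - v j)) *
        ∏ j ∈ (Finset.range M).erase a, (v' a - v j)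
  | 0, ha => by omega
  | M + 1, ha => by
    rw [Finset.prod_range_succ, Finset.prod_range_succ]
    rcases Nat.lt_or_ge a M with hM | hM
    · have e : (Finset.range (M + 1)).erase a = insert M ((Finset.range M).erase a) := by
        ext j; simp; omega
      have hM' : M ∉ (Finset.range M).erase a := by simp
      have ih := prod_prod_sub_update h hM
      have e1 : ∏ k ∈ (Finset.range M).erase a, (v' k - v M) =
          ∏ k ∈ (Finset.range M).erase a, (v k - v M) :=
        Finset.prod_congr rfl fun k hk => by rw [h k (Finset.mem_erase.1 hk).1]
      rw [e, Finset.prod_insert hM', Finset.prod_insert hM', h M hM.ne',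
        ← Finset.mul_prod_erase (Finset.range M) (fun k => v' k - v M) (Finset.mem_range.2 hM),
        ← Finset.mul_prod_erase (Finset.range M) (fun k => v k - v M) (Finset.mem_range.2 hM), e1]
      linear_combination (v' a - v M) * (v a - v M) *
        (∏ k ∈ (Finset.range M).erase a, (v k - v M)) * ih
    · obtain rfl : a = M := by omega
      have e : (Finset.range (a + 1)).erase a = Finset.range a := by
        ext j; simp; omega
      have e1 : ∏ j ∈ Finset.range a, ∏ k ∈ Finset.range j, (v' k - v' j) =
          ∏ j ∈ Finset.range a, ∏ k ∈ Finset.range j, (v k - v j) :=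
        Finset.prod_congr rfl fun j hj => Finset.prod_congr rfl fun k hk => by
          have hj := Finset.mem_range.1 hj
          have hk := Finset.mem_range.1 hk
          rw [h k (by omega), h j (by omega)]
      rw [e, e1, mul_assoc, mul_assoc]
      congr 1
      rw [← Finset.prod_mul_distrib, ← Finset.prod_mul_distrib]
      refine Finset.prod_congr rfl fun k hk => ?_
      have hk := Finset.mem_range.1 hk
      rw [h k (by omega)]
      ring

/-- The factor of the trace of `E_T` contributed by the cell `(i, j)`. -/
def cellFactor (Q : K) (N i j : ℕ) : K :=
  (q ^ (2 * ((j : ℤ) - i)) - (1 - 𝔷 * Q)) * (1 - (q ^ 2)⁻¹) * (q ^ 2)⁻¹ ^ (N - 1) /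
    (𝔷 * (q ^ 2 * q ^ (2 * ((j : ℤ) - i)) - q ^ (2 * (-(N : ℤ)))))

/-- The trace of `E_T`, up to a constant factor, in terms of the row lengths. -/
def shapeTrace (Q : K) (N : ℕ) (l : ℕ → ℕ) : K :=
  (∏ j ∈ Finset.range (N + 1), ∏ k ∈ Finset.range j, (node l k - node l j)) *
    ∏ i ∈ Finset.range N, ∏ j ∈ Finset.range (l i), cellFactor Q N i j

theorem shapeTrace_zero_ne_zero (Q : K) (N : ℕ) : shapeTrace Q N 0 ≠ 0 := by
  refine mul_ne_zero (Finset.prod_ne_zero_iff.2 fun j _ =>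
    Finset.prod_ne_zero_iff.2 fun k hk => ?_) (by simp)
  exact sub_ne_zero.2 fun h => (Finset.mem_range.1 hk).ne (node_injective antitone_const h)

/-- Writing x_a - q⁻²x_j as q⁻²(q²x_a - x_j) for j ≠ a, the weight becomes the ratio of the new
Vandermonde product to the old one, times a factor depending only on the new cell, N and Q. The
denominator q²x_a - x_N in `cellFactor` compensates for row N, which is absent from the numerator.
-/
theorem weight_mul_shapeTrace {Q : K} {N : ℕ} {l l' : ℕ → ℕ} {a : ℕ} (hl : Antitone l)
    (hN : l N = 0) (ha : a < N) (hne : ∀ i, i ≠ a → l' i = l i) (hla : l' a = l a + 1) :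
    weight Q N l a * shapeTrace Q N l = shapeTrace Q N l' := by
  have hV := prod_prod_sub_update (v := node l) (v' := node l') (a := a)
    (fun j hj => node_congr (hne j hj)) (M := N + 1) (by omega)
  have hC : ∏ i ∈ Finset.range N, ∏ j ∈ Finset.range (l' i), cellFactor Q N i j =
      cellFactor Q N a (l a) *
        ∏ i ∈ Finset.range N, ∏ j ∈ Finset.range (l i), cellFactor Q N i j := by
    rw [← Finset.mul_prod_erase _ _ (Finset.mem_range.2 ha),
      ← Finset.mul_prod_erase (Finset.range N) _ (Finset.mem_range.2 ha), hla,
      Finset.prod_range_succ, mul_comm (∏ j ∈ Finset.range (l a), cellFactor Q N a j), mul_assoc]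
    congr 2
    refine Finset.prod_congr rfl fun i hi => ?_
    rw [hne i (Finset.mem_erase.1 hi).1]
  have e : (Finset.range (N + 1)).erase a = insert N ((Finset.range N).erase a) := by
    ext j; simp; omega
  have hN' : N ∉ (Finset.range N).erase a := by simp
  have n1 : ∏ j ∈ (Finset.range (N + 1)).erase a, (node l a - node l j) ≠ 0 :=
    Finset.prod_ne_zero_iff.2 fun j hj =>
      sub_ne_zero.2 fun h => (Finset.mem_erase.1 hj).1 (node_injective hl h).symm
  have n2 := node_ne_zero l a
  have n3 := z_ne_zero
  have n4 := q_ne_zero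
  have hNN : node l N = q ^ (2 * (-(N : ℤ))) := by simp [node, hN]
  have n5 : q ^ 2 * node l a - node l N ≠ 0 := by
    rw [node, node, ← zpow_natCast, ← zpow_add₀ n4, sub_ne_zero]
    intro h
    have := q_zpow_injective h
    push_cast at this
    omega
  have e1 : ∏ j ∈ (Finset.range N).erase a, (node l a - (q ^ 2)⁻¹ * node l j) =
      (q ^ 2)⁻¹ ^ (N - 1) * ∏ j ∈ (Finset.range N).erase a, (q ^ 2 * node l a - node l j) := by
    have hcard : ((Finset.range N).erase a).card = N - 1 := by
      rw [Finset.card_erase_of_mem (Finset.mem_range.2 ha), Finset.card_range]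
    rw [← hcard, ← Finset.prod_const, ← Finset.prod_mul_distrib]
    exact Finset.prod_congr rfl fun j _ => by field_simp
  rw [shapeTrace, shapeTrace, hC]
  rw [e, Finset.prod_insert hN', Finset.prod_insert hN', node_succ hla] at hV
  rw [e, Finset.prod_insert hN'] at n1
  rw [weight, eval_numer, ← Finset.mul_prod_erase _ _ (Finset.mem_range.2 ha), e1, e,
    Finset.prod_insert hN', cellFactor, ← hNN]
  change _ = _ * ((node l a - (1 - 𝔷 * Q)) * (1 - (q ^ 2)⁻¹) * (q ^ 2)⁻¹ ^ (N - 1) /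
    (𝔷 * (q ^ 2 * node l a - node l N)) * _)
  have e2 : node l a - (q ^ 2)⁻¹ * node l a = node l a * (1 - (q ^ 2)⁻¹) := by ring
  rw [e2]
  generalize (∏ i ∈ Finset.range N, ∏ j ∈ Finset.range (l i), cellFactor Q N i j) = C
  generalize (q ^ 2)⁻¹ ^ (N - 1) = r
  generalize 1 - (q ^ 2)⁻¹ = r'
  generalize (∏ j ∈ Finset.range (N + 1), ∏ k ∈ Finset.range j, (node l' k - node l' j)) = V' at *
  generalize (∏ j ∈ Finset.range (N + 1), ∏ k ∈ Finset.range j, (node l k - node l j)) = V at *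
  generalize node l a - (1 - 𝔷 * Q) = A
  generalize ∏ j ∈ (Finset.range N).erase a, (q ^ 2 * node l a - node l j) = B at *
  generalize ∏ j ∈ (Finset.range N).erase a, (node l a - node l j) = D at *
  generalize q ^ 2 * node l a - node l N = y at *
  generalize node l a - node l N = y' at *
  generalize (q - q⁻¹ : K) = z at *
  obtain ⟨m1, m2⟩ := mul_ne_zero_iff.1 n1
  field_simp
  linear_combination -(A * r' * r * C) * hV

/-! ### Jucys–Murphy elements and the traces of their powers -/

theorem jucysMurphy_succ (n : ℕ) : jucysMurphy (n + 1) =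
    tgen (n + 2) (n + 1) * incl (n + 1) (jucysMurphy n) * tgen (n + 2) (n + 1) := by
  rw [jucysMurphy, gen_lastIdx]

/-- Lower generators commute with each factor of the recursive definition. For the highest generator
s of the subalgebra the element is t s Y s t with Y commuting with t, and the braid relation,
applied twice, carries s across. -/
theorem commute_jucysMurphy_incl (n : ℕ) (x : Hecke n) : Commute (jucysMurphy n) (incl n x) := by
  induction n with
  | zero => exact Commute.one_left _
  | succ n ih =>
    refine commute_map_of_commute_gen (incl (n + 1)) (fun i => ?_) x
    rw [jucysMurphy_succ]
    rcases Nat.lt_or_ge i.1 n with hi | hi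
    · have e : gen i = incl n (gen ⟨i.1, i.2.1, hi⟩) := (incl_gen ⟨i.1, i.2.1, hi⟩).symm
      rw [e]
      have h1 := commute_tgen_incl_incl n (gen ⟨i.1, i.2.1, hi⟩)
      exact (h1.mul_left ((ih _).map (incl (n + 1)))).mul_left h1
    · have hi' : i.1 = n := by have := i.2.2; omega
      obtain ⟨k, rfl⟩ : ∃ k, n = k + 1 := ⟨n - 1, by have := i.2.1; omega⟩
      rw [gen_eq_tgen, hi', jucysMurphy_succ, map_mul, map_mul, incl_tgen (by omega)]
      have hY : Commute (tgen (k + 1 + 2) (k + 1 + 1))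
        (incl (k + 1 + 1) (incl (k + 1) (jucysMurphy k))) := commute_tgen_incl_incl _ _
      have hbr : tgen (k + 1 + 2) (k + 1) * tgen (k + 1 + 2) (k + 1 + 1) *
          tgen (k + 1 + 2) (k + 1) = tgen (k + 1 + 2) (k + 1 + 1) * tgen (k + 1 + 2) (k + 1) *
          tgen (k + 1 + 2) (k + 1 + 1) := tgen_braid (by omega) (by omega)
      generalize incl (k + 1 + 1) (incl (k + 1) (jucysMurphy k)) = Y at hY
      generalize tgen (k + 1 + 2) (k + 1 + 1) = t at *
      generalize tgen (k + 1 + 2) (k + 1) = s at *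
      change t * (s * Y * s) * t * s = s * (t * (s * Y * s) * t)
      calc t * (s * Y * s) * t * s = t * s * Y * (s * t * s) := by simp only [mul_assoc]
        _ = t * s * (Y * t) * s * t := by rw [hbr]; simp only [mul_assoc]
        _ = (t * s * t) * Y * s * t := by rw [← hY.eq]; simp only [mul_assoc]
        _ = s * (t * (s * Y * s) * t) := by rw [← hbr]; simp only [mul_assoc]

/-- The recurrence for the partial traces of the powers of the Jucys–Murphy elements. -/
theorem partialTrace_jucysMurphy_pow (Q : K) (n : ℕ) : ∃ t s : ℕ → Hecke (n + 1),
    t 0 = 1 ∧ s 0 = 0 ∧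
    (∀ k, t (k + 1) = jucysMurphy n * t k +
      𝔷 • partialTrace Q (n + 1) (jucysMurphy (n + 1) ^ (k + 1))) ∧
    (∀ k, s (k + 1) = jucysMurphy n * (s k + t k)) ∧
    ∀ k, partialTrace Q (n + 1) (jucysMurphy (n + 1) ^ k) =
      incl n (partialTrace Q n (jucysMurphy n ^ k)) + 𝔷 • s k := by
  have hbm := partialTrace_bimodule Q (n + 1)
  have hconj (X) := (partialTrace_conj_aux Q n X).1
  have hT : partialTrace Q (n + 1) (tgen (n + 2) (n + 1)) = 1 := partialTrace_tgen Q (by omega)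
  have hcomm : jucysMurphy (n + 1) * incl (n + 1) (jucysMurphy n) =
    incl (n + 1) (jucysMurphy n) * jucysMurphy (n + 1) := (commute_jucysMurphy_incl (n + 1) _).eq
  have htt : tgen (n + 2) (n + 1) * tgen (n + 2) (n + 1) = 1 + 𝔷 • tgen (n + 2) (n + 1) :=
    tgen_quad (by omega) (by omega)
  have hy := jucysMurphy_succ n
  set t := tgen (n + 2) (n + 1) with ht
  set y := jucysMurphy n
  set y' := jucysMurphy (n + 1)
  set Tr := partialTrace Q (n + 1)
  have hyt : y' * t = t * incl (n + 1) y + 𝔷 • y' := by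
    rw [hy, mul_assoc, htt, mul_add, mul_one, mul_smul_comm]
  -- S_k is the sum of y^{k-j} y'^j over 1 ≤ j ≤ k, the correction term in y'^k t = t y^k + z S_k.
  let S : ℕ → Hecke (n + 2) := fun k => Nat.rec 0 (fun k r => incl (n + 1) y * r + y' ^ (k + 1)) k
  have hS (k) : S (k + 1) = incl (n + 1) y * S k + y' ^ (k + 1) := rfl
  have hS' (k) : S (k + 1) = y' * (incl (n + 1) y ^ k + S k) := by
    induction k with
    | zero => simp [S]
    | succ k ih =>
      rw [hS (k + 1)]
      nth_rw 1 [ih]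
      rw [← mul_assoc, ← hcomm, mul_assoc, mul_add (incl (n + 1) y), ← pow_succ',
        pow_succ' y' (k + 1), ← mul_add, hS k, add_assoc (_ ^ _)]
  have hpow (k) : y' ^ k * t = t * incl (n + 1) (y ^ k) + 𝔷 • S k := by
    induction k with
    | zero => simp [S]
    | succ k ih =>
      rw [pow_succ', mul_assoc, ih, mul_add, ← mul_assoc, hyt, hS', pow_succ' y, map_mul, map_pow]
      simp only [mul_add, add_mul, mul_assoc, smul_add, smul_mul_assoc, mul_smul_comm]
      abel
  have hTt (k) : Tr (y' ^ k * t) = y ^ k + 𝔷 • Tr (S k) := by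
    rw [hpow, map_add, map_smul, trace_mul_incl hbm, hT, one_mul]
  have h1 (k) : Tr (y' ^ (k + 1) * t) = y * Tr (y' ^ k * t) + 𝔷 • Tr (y' ^ (k + 1)) := by
    rw [hTt, hTt, hS, map_add, trace_incl_mul hbm, pow_succ']
    simp only [mul_add, smul_add, mul_smul_comm, add_assoc]
  -- The witnesses are the traces of y'^k t and S_k t⁻¹, since t⁻¹ = t - z.
  refine ⟨fun k => Tr (y' ^ k * t), fun k => Tr (S k * (t - 𝔷 • 1)), ?_, ?_, h1, fun k => ?_,
    fun k => ?_⟩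
  · simpa using hT
  · simp [S]
  · change Tr (S (k + 1) * (t - 𝔷 • 1)) = y * (Tr (S k * (t - 𝔷 • 1)) + Tr (y' ^ k * t))
    rw [hS, add_mul, map_add, mul_assoc, trace_incl_mul hbm, mul_sub (y' ^ _), map_sub, h1,
      mul_smul_comm, mul_one, map_smul, add_sub_cancel_right, mul_add]
  · change _ = _ + 𝔷 • Tr (S k * (t - 𝔷 • 1))
    have e : t * (t - 𝔷 • 1) = 1 := by simp [mul_sub, htt]
    -- Multiplying by t⁻¹ gives y'^k = t y^k t⁻¹ + z S_k t⁻¹, and conjugation invariance evaluates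
    -- the first term.
    rw [← hconj, ← map_smul, ← map_add, ← smul_mul_assoc, ← add_mul, ← hpow, mul_assoc, e, mul_one]

/-! ### Row lengths of tableaux and addable cells -/

theorem rowLen_eq_zero_of_tableau_zero (T : StandardTableau 0) : T.shape.rowLen = 0 := by
  funext i
  by_contra h
  have : (i, 0) ∈ T.shape := YoungDiagram.mem_iff_lt_rowLen.2 (Nat.pos_of_ne_zero h)
  obtain ⟨b, -⟩ := T.bijOn.surjOn this
  exact b.elim0

theorem antitone_rowLen (μ : YoungDiagram) : Antitone μ.rowLen := fun _ _ h => μ.rowLen_anti _ _ h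

section
variable {n : ℕ} (T : StandardTableau (n + 1))

theorem mem_removeLast_shape (c : ℕ × ℕ) :
    c ∈ T.removeLast.shape ↔ c ≠ T.cell (Fin.last n) ∧ c ∈ T.shape := Finset.mem_erase

theorem cell_last_mem : T.cell (Fin.last n) ∈ T.shape := T.bijOn.mapsTo (Set.mem_univ _)

theorem rowLen_removeLast_of_ne {i : ℕ} (hi : i ≠ (T.cell (Fin.last n)).1) :
    T.shape.rowLen i = T.removeLast.shape.rowLen i := by
  refine eq_of_forall_lt_iff fun j => ?_
  rw [← YoungDiagram.mem_iff_lt_rowLen, ← YoungDiagram.mem_iff_lt_rowLen, mem_removeLast_shape]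
  exact ⟨fun h => ⟨fun e => hi (congrArg Prod.fst e), h⟩, fun h => h.2⟩

theorem rowLen_removeLast_cell : T.removeLast.shape.rowLen (T.cell (Fin.last n)).1 =
    (T.cell (Fin.last n)).2 := by
  have h1 (j) : j < T.removeLast.shape.rowLen (T.cell (Fin.last n)).1 ↔
      j ≠ (T.cell (Fin.last n)).2 ∧ j < T.shape.rowLen (T.cell (Fin.last n)).1 := by
    rw [← YoungDiagram.mem_iff_lt_rowLen, ← YoungDiagram.mem_iff_lt_rowLen, mem_removeLast_shape,
      Ne, Prod.ext_iff]
    simp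
  have h2 : (T.cell (Fin.last n)).2 < T.shape.rowLen (T.cell (Fin.last n)).1 :=
    YoungDiagram.mem_iff_lt_rowLen.1 (cell_last_mem T)
  have h3 := h1 (T.cell (Fin.last n)).2
  have h4 := h1 (T.removeLast.shape.rowLen (T.cell (Fin.last n)).1)
  omega

theorem rowLen_cell_last : T.shape.rowLen (T.cell (Fin.last n)).1 =
    T.removeLast.shape.rowLen (T.cell (Fin.last n)).1 + 1 := by
  have h1 (j) : j < T.removeLast.shape.rowLen (T.cell (Fin.last n)).1 ↔
      j ≠ (T.cell (Fin.last n)).2 ∧ j < T.shape.rowLen (T.cell (Fin.last n)).1 := by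
    rw [← YoungDiagram.mem_iff_lt_rowLen, ← YoungDiagram.mem_iff_lt_rowLen, mem_removeLast_shape,
      Ne, Prod.ext_iff]
    simp
  have h2 : (T.cell (Fin.last n)).2 < T.shape.rowLen (T.cell (Fin.last n)).1 :=
    YoungDiagram.mem_iff_lt_rowLen.1 (cell_last_mem T)
  have h3 := h1 ((T.cell (Fin.last n)).2 + 1)
  rw [rowLen_removeLast_cell] at *
  omega

theorem cell_last_row_lt {N : ℕ} (hN : T.shape.rowLen N = 0) : (T.cell (Fin.last n)).1 < N := by
  by_contra h
  have h1 := T.shape.rowLen_anti _ _ (not_lt.1 h)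
  have h2 := rowLen_cell_last T
  omega

theorem rowLen_removeLast_eq_zero {N : ℕ} (hN : T.shape.rowLen N = 0) :
    T.removeLast.shape.rowLen N = 0 := by
  rw [← rowLen_removeLast_of_ne T (cell_last_row_lt T hN).ne', hN]

theorem qContent_cell_last : qContent (T.cell (Fin.last n)) =
    node T.removeLast.shape.rowLen (T.cell (Fin.last n)).1 := by
  rw [qContent, node, rowLen_removeLast_cell]

end

theorem snd_eq_rowLen_of_mem_addable {μ : YoungDiagram} {c : ℕ × ℕ} (h : c ∈ addable μ) :
    c.2 = μ.rowLen c.1 := by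
  obtain ⟨h1, h2⟩ := (mem_addable μ c).1 h
  have h1 : ¬ c.2 < μ.rowLen c.1 := fun h => h1 (YoungDiagram.mem_iff_lt_rowLen.2 h)
  by_contra hne
  have h3 := h2 (show (c.1, c.2 - 1) ≤ c from ⟨le_rfl, Nat.sub_le _ _⟩) (by simp)
  rcases Finset.mem_insert.1 (Finset.mem_coe.1 h3) with h3 | h3
  · have := congrArg Prod.snd h3
    simp only at this
    omega
  · have := YoungDiagram.mem_iff_lt_rowLen.1 ((YoungDiagram.mem_cells _).1 h3)
    omega

theorem row_end_mem_addable {μ : YoungDiagram} {i : ℕ}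
    (h : ∀ j, i = j + 1 → μ.rowLen i < μ.rowLen j) : (i, μ.rowLen i) ∈ addable μ := by
  rw [mem_addable]
  refine ⟨fun h => (YoungDiagram.mem_iff_lt_rowLen.1 h).false, fun x y hyx hx => ?_⟩
  rcases Finset.mem_insert.1 (Finset.mem_coe.1 hx) with rfl | hx
  · obtain ⟨i', j'⟩ := y
    have h1 : i' ≤ i := hyx.1
    have h2 : j' ≤ μ.rowLen i := hyx.2
    refine Finset.mem_coe.2 (Finset.mem_insert.2 ?_)
    rw [YoungDiagram.mem_cells, YoungDiagram.mem_iff_lt_rowLen, Prod.mk.injEq]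
    rcases h1.eq_or_lt with rfl | h1
    · rcases h2.eq_or_lt with rfl | h2
      · exact Or.inl ⟨rfl, rfl⟩
      · exact Or.inr h2
    · obtain ⟨j, rfl⟩ : ∃ j, i = j + 1 := ⟨i - 1, by omega⟩
      have h3 := h j rfl
      have h4 := μ.rowLen_anti i' j (by omega)
      exact Or.inr (by omega)
  · exact Finset.mem_coe.2 (Finset.mem_insert_of_mem (μ.isLowerSet hyx hx))

/-- The integral of `contentPoly * s` picks out the new cell. -/
theorem sum_weight_mul_eval_contentPoly {n : ℕ} (T : StandardTableau (n + 1)) (Q : K) {N : ℕ}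
    (hN : T.shape.rowLen N = 0) (s : Polynomial K) :
    ∑ i ∈ Finset.range (N + 1), weight Q N T.removeLast.shape.rowLen i *
      (contentPoly T.removeLast.shape (T.cell (Fin.last n)) * s).eval
        (node T.removeLast.shape.rowLen i) =
    weight Q N T.removeLast.shape.rowLen (T.cell (Fin.last n)).1 *
      s.eval (qContent (T.cell (Fin.last n))) := by
  have ha := cell_last_row_lt T hN
  have hα := qContent_cell_last T
  have hb := rowLen_removeLast_cell T
  set μ := T.removeLast.shape
  set α := T.cell (Fin.last n)
  rw [Finset.sum_eq_single α.1]
  · rw [← hα, Polynomial.eval_mul, contentPoly, Polynomial.eval_prod, Finset.prod_eq_one, one_mul]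
    intro c hc
    obtain ⟨hc1, hc2⟩ := Finset.mem_erase.1 hc
    have hc3 := snd_eq_rowLen_of_mem_addable hc2
    have hc4 : qContent c = node μ.rowLen c.1 := by rw [qContent, node, hc3]
    rw [Polynomial.eval_mul, Polynomial.eval_C, Polynomial.eval_sub, Polynomial.eval_X,
      Polynomial.eval_C, inv_mul_cancel₀]
    rw [hα, hc4, sub_ne_zero]
    intro h
    have h5 := node_injective (antitone_rowLen μ) h
    exact hc1 (Prod.ext h5.symm (by rw [hc3, ← h5, hb]))
  · intro i hi hia
    -- A row other than that of the new cell either ends at an addable cell, whose factor kills the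
    -- content polynomial, or is as long as the row above and has weight zero.
    by_cases h : ∀ j, i = j + 1 → μ.rowLen i < μ.rowLen j
    · have hm : (i, μ.rowLen i) ∈ (addable μ).erase α :=
        Finset.mem_erase.2 ⟨fun h => hia (congrArg Prod.fst h), row_end_mem_addable h⟩
      rw [Polynomial.eval_mul, contentPoly, Polynomial.eval_prod, Finset.prod_eq_zero hm, zero_mul,
        mul_zero]
      simp [qContent, node]
    · push Not at h
      obtain ⟨j, rfl, hj⟩ := h
      have := Finset.mem_range.1 hi
      rw [weight_eq_zero (by omega) (le_antisymm (μ.rowLen_anti _ _ (by omega)) hj), zero_mul]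
  · intro h
    exact absurd (Finset.mem_range.2 (by omega)) h

/-! ### Evaluation at contents under the trace -/

/-- The pairs of a polynomial in the Jucys–Murphy elements and its value at the contents of `T`. -/
def jmPairs : (n : ℕ) → StandardTableau n → Subalgebra K (Hecke n × K)
  | 0, _ => ⊥
  | n + 1, T => Algebra.adjoin K
      ((fun p : Hecke n × K => (incl n p.1, p.2)) '' (jmPairs n T.removeLast) ∪
        {(jucysMurphy n, qContent (T.cell (Fin.last n)))})

section
variable {n : ℕ} (T : StandardTableau (n + 1))

theorem incl_mem_jmPairs {X : Hecke n} {x : K} (h : (X, x) ∈ jmPairs n T.removeLast) :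
    (incl n X, x) ∈ jmPairs (n + 1) T :=
  Algebra.subset_adjoin (Or.inl ⟨_, h, rfl⟩)

theorem jucysMurphy_mem_jmPairs :
    (jucysMurphy n, qContent (T.cell (Fin.last n))) ∈ jmPairs (n + 1) T :=
  Algebra.subset_adjoin (Or.inr rfl)

/-- The spanning set is closed under products because the last Jucys–Murphy element commutes with
the embedded H_n. -/
theorem jmPairs_succ_le_span {p : Hecke (n + 1) × K} (hp : p ∈ jmPairs (n + 1) T) :
    p ∈ Submodule.span K {r | ∃ X x k, (X, x) ∈ jmPairs n T.removeLast ∧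
      r = (incl n X * jucysMurphy n ^ k, x * qContent (T.cell (Fin.last n)) ^ k)} := by
  induction hp using Algebra.adjoin_induction with
  | mem p hp =>
    refine Submodule.subset_span ?_
    rcases hp with ⟨⟨X, x⟩, hX, rfl⟩ | rfl
    · exact ⟨X, x, 0, hX, by simp⟩
    · exact ⟨1, 1, 1, one_mem _, by simp⟩
  | algebraMap r =>
    rw [Algebra.algebraMap_eq_smul_one]
    exact Submodule.smul_mem _ _ (Submodule.subset_span ⟨1, 1, 0, one_mem _, by simp; rfl⟩)
  | add p p' _ _ hp hp' => exact Submodule.add_mem _ hp hp'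
  | mul p p' _ _ hp hp' =>
    have := Submodule.mul_mem_mul hp hp'
    rw [Submodule.span_mul_span] at this
    refine Submodule.span_mono ?_ this
    rintro _ ⟨_, ⟨X, x, k, hX, rfl⟩, _, ⟨X', x', k', hX', rfl⟩, rfl⟩
    refine ⟨X * X', x * x', k + k', mul_mem hX hX', ?_⟩
    have hc := ((commute_jucysMurphy_incl n X').pow_left k).eq
    refine Prod.ext ?_ ?_
    · change incl n X * jucysMurphy n ^ k * (incl n X' * jucysMurphy n ^ k') = _
      rw [mul_assoc, ← mul_assoc (jucysMurphy n ^ k), hc, map_mul, pow_add]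
      simp only [mul_assoc]
    · change x * _ * (x' * _) = _
      rw [pow_add]
      ring

end

/-- Algebra element and scalar are produced by the same recurrence, with y and its content c in
corresponding places, so membership propagates through it. -/
theorem partialTrace_pow_mem_jmPairs (Q : K) : ∀ (n : ℕ) (T : StandardTableau n) {N : ℕ},
    T.shape.rowLen N = 0 → ∀ k, (partialTrace Q n (jucysMurphy n ^ k),
      moment Q N T.shape.rowLen k) ∈ jmPairs n T
  | 0, T, N, _, k => by
    have e : (partialTrace Q 0 (jucysMurphy 0 ^ k), moment Q N T.shape.rowLen k) =
        algebraMap K (Hecke 0 × K) Q := by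
      rw [rowLen_eq_zero_of_tableau_zero, moment_zero_shape, jucysMurphy, one_pow,
        ← map_one (incl 0), partialTrace_incl, Algebra.algebraMap_eq_smul_one]
      exact Prod.ext rfl (mul_one Q).symm
    rw [e]
    exact Subalgebra.algebraMap_mem _ _
  | n + 1, T, N, hN, k => by
    have ih := partialTrace_pow_mem_jmPairs Q n T.removeLast (rowLen_removeLast_eq_zero T hN)
    obtain ⟨t, s, ht0, hs0, ht, hs, hM⟩ := partialTrace_jucysMurphy_pow Q n
    set c := qContent (T.cell (Fin.last n)) with hc
    -- The scalar shadow of the sequences t and s, with y replaced by c and the partial trace by the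
    -- moment.
    let ts : ℕ → K × K := fun k => Nat.rec (1, 0)
      (fun k r => (c * r.1 + 𝔷 * moment Q N T.shape.rowLen (k + 1), c * (r.2 + r.1))) k
    have hm : ∀ k, moment Q N T.shape.rowLen k =
        moment Q N T.removeLast.shape.rowLen k + 𝔷 * (ts k).2 :=
      moment_eq (t := fun k => (ts k).1) (antitone_rowLen _) (antitone_rowLen _)
        (rowLen_removeLast_eq_zero T hN) (cell_last_row_lt T hN)
        (fun i hi => rowLen_removeLast_of_ne T hi) (rowLen_cell_last T) rfl rfl
        (fun k => by rw [← qContent_cell_last]) (fun k => by rw [← qContent_cell_last])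
    have hmem (k) (h : (s k, (ts k).2) ∈ jmPairs (n + 1) T) :
        (partialTrace Q (n + 1) (jucysMurphy (n + 1) ^ k), moment Q N T.shape.rowLen k) ∈
          jmPairs (n + 1) T := by
      rw [hM, hm]
      exact add_mem (incl_mem_jmPairs T (ih k)) (Subalgebra.smul_mem _ h 𝔷)
    have key (k) : (t k, (ts k).1) ∈ jmPairs (n + 1) T ∧ (s k, (ts k).2) ∈ jmPairs (n + 1) T := by
      induction k with
      | zero => rw [ht0, hs0]; exact ⟨one_mem _, zero_mem _⟩
      | succ k ih =>
        have h2 : (s (k + 1), (ts (k + 1)).2) ∈ jmPairs (n + 1) T := by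
          rw [hs]
          exact mul_mem (jucysMurphy_mem_jmPairs T) (add_mem ih.2 ih.1)
        refine ⟨?_, h2⟩
        rw [ht]
        exact add_mem (mul_mem (jucysMurphy_mem_jmPairs T) ih.1)
          (Subalgebra.smul_mem _ (hmem (k + 1) h2) 𝔷)
    exact hmem k (key k).2

theorem partialTrace_aeval_mem_jmPairs (Q : K) {n : ℕ} (T : StandardTableau n) {N : ℕ}
    (hN : T.shape.rowLen N = 0) (p : Polynomial K) :
    (partialTrace Q n (Polynomial.aeval (jucysMurphy n) p),
      ∑ i ∈ Finset.range (N + 1), weight Q N T.shape.rowLen i *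
        p.eval (node T.shape.rowLen i)) ∈ jmPairs n T := by
  induction p using Polynomial.induction_on' with
  | add p p' hp hp' =>
    simp only [map_add, Polynomial.eval_add, mul_add, Finset.sum_add_distrib]
    exact add_mem hp hp'
  | monomial k r =>
    have e : ∑ i ∈ Finset.range (N + 1), weight Q N T.shape.rowLen i *
        (Polynomial.monomial k r).eval (node T.shape.rowLen i) =
        r * moment Q N T.shape.rowLen k := by
      rw [moment, Finset.mul_sum]
      refine Finset.sum_congr rfl fun i _ => ?_
      rw [Polynomial.eval_monomial]
      ring
    rw [e, Polynomial.aeval_monomial, ← Algebra.smul_def, map_smul]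
    exact Subalgebra.smul_mem _ (partialTrace_pow_mem_jmPairs Q n T hN k) r

/-- The inner trace turns E_T X y^k into E_U X times the partial trace of a polynomial in y. By
induction that trace acts as the scalar ∑ w_i P(x_i) x_i^k, in which the content polynomial P keeps
only the new cell. -/
theorem totalTrace_idempotent_mul_aux (Q : K) {n : ℕ} (T : StandardTableau (n + 1)) {N : ℕ}
    (hN : T.shape.rowLen N = 0)
    (ih : ∀ p ∈ jmPairs n T.removeLast, totalTrace (partialTrace Q) n
      (idempotent n T.removeLast * p.1) =
        p.2 * totalTrace (partialTrace Q) n (idempotent n T.removeLast))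
    {X : Hecke n} {x : K} (hX : (X, x) ∈ jmPairs n T.removeLast) (k : ℕ) :
    totalTrace (partialTrace Q) (n + 1) (idempotent (n + 1) T * (incl n X * jucysMurphy n ^ k)) =
      x * qContent (T.cell (Fin.last n)) ^ k *
        (weight Q N T.removeLast.shape.rowLen (T.cell (Fin.last n)).1 *
          totalTrace (partialTrace Q) n (idempotent n T.removeLast)) := by
  set P := contentPoly T.removeLast.shape (T.cell (Fin.last n)) with hP
  have hc : Commute (Polynomial.aeval (jucysMurphy n) P) (incl n X) := by
    induction P using Polynomial.induction_on' with
    | add p p' hp hp' => rw [map_add]; exact hp.add_left hp'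
    | monomial k r =>
      rw [Polynomial.aeval_monomial]
      exact Commute.mul_left (Algebra.commutes r _)
        ((commute_jucysMurphy_incl n X).pow_left k)
  have e : idempotent (n + 1) T * (incl n X * jucysMurphy n ^ k) =
      incl n (idempotent n T.removeLast * X) *
        Polynomial.aeval (jucysMurphy n) (P * Polynomial.X ^ k) := by
    rw [idempotent, ← hP, mul_assoc, ← mul_assoc _ (incl n X), hc.eq, map_mul, map_mul, map_pow,
      Polynomial.aeval_X]
    simp only [mul_assoc]
  have h1 := partialTrace_aeval_mem_jmPairs Q T.removeLast (rowLen_removeLast_eq_zero T hN)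
    (P * Polynomial.X ^ k)
  rw [sum_weight_mul_eval_contentPoly T Q hN] at h1
  have h2 := ih _ (mul_mem hX h1)
  rw [e, totalTrace, LinearMap.comp_apply, trace_incl_mul (partialTrace_bimodule Q n), mul_assoc]
  refine h2.trans ?_
  change x * _ * _ = _
  rw [Polynomial.eval_pow, Polynomial.eval_X]
  ring

/-- A trace form of the statement that E_T is a joint eigenvector of the Jucys–Murphy elements with
eigenvalues the contents. -/
theorem totalTrace_idempotent_mul (Q : K) : ∀ (n : ℕ) (T : StandardTableau n) {N : ℕ},
    T.shape.rowLen N = 0 → ∀ p ∈ jmPairs n T,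
      totalTrace (partialTrace Q) n (idempotent n T * p.1) =
        p.2 * totalTrace (partialTrace Q) n (idempotent n T)
  | 0, T, N, _, p, hp => by
    obtain ⟨r, rfl⟩ := Algebra.mem_bot.1 hp
    rw [Algebra.algebraMap_eq_smul_one]
    simp
  | n + 1, T, N, hN, p, hp => by
    have ih := totalTrace_idempotent_mul Q n T.removeLast (rowLen_removeLast_eq_zero T hN)
    have h1 := totalTrace_idempotent_mul_aux Q T hN ih (X := 1) (x := 1) (one_mem _) 0
    simp only [map_one, pow_zero, mul_one, one_mul] at h1
    rw [h1]
    replace hp := jmPairs_succ_le_span T hp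
    induction hp using Submodule.span_induction with
    | mem p hp =>
      obtain ⟨X, x, k, hX, rfl⟩ := hp
      exact totalTrace_idempotent_mul_aux Q T hN ih hX k
    | zero => simp
    | add p p' _ _ hp hp' => simp [mul_add, add_mul, hp, hp']
    | smul r p _ hp => simp [hp, mul_assoc]

theorem totalTrace_idempotent_succ (Q : K) {n : ℕ} (T : StandardTableau (n + 1)) {N : ℕ}
    (hN : T.shape.rowLen N = 0) : totalTrace (partialTrace Q) (n + 1) (idempotent (n + 1) T) =
      weight Q N T.removeLast.shape.rowLen (T.cell (Fin.last n)).1 *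
        totalTrace (partialTrace Q) n (idempotent n T.removeLast) := by
  have ih := totalTrace_idempotent_mul Q n T.removeLast (rowLen_removeLast_eq_zero T hN)
  simpa using totalTrace_idempotent_mul_aux Q T hN ih (X := 1) (x := 1) (one_mem _) 0

theorem totalTrace_idempotent (Q : K) : ∀ (n : ℕ) (T : StandardTableau n) {N : ℕ},
    T.shape.rowLen N = 0 → totalTrace (partialTrace Q) n (idempotent n T) * shapeTrace Q N 0 =
      shapeTrace Q N T.shape.rowLen
  | 0, T, N, _ => by
    rw [rowLen_eq_zero_of_tableau_zero, idempotent]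
    simp [totalTrace]
  | n + 1, T, N, hN => by
    have hN' := rowLen_removeLast_eq_zero T hN
    rw [totalTrace_idempotent_succ Q T hN, mul_assoc, totalTrace_idempotent Q n _ hN',
      weight_mul_shapeTrace (antitone_rowLen _) hN' (cell_last_row_lt T hN)
        (fun i hi => rowLen_removeLast_of_ne T hi) (rowLen_cell_last T)]

theorem exists_rowLen_eq_zero (μ : YoungDiagram) : ∃ N, μ.rowLen N = 0 := by
  refine ⟨μ.colLen 0, ?_⟩
  by_contra h
  have := YoungDiagram.mem_iff_lt_colLen.1
    (YoungDiagram.mem_iff_lt_rowLen.2 (Nat.pos_of_ne_zero h))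
  exact this.false

end HeckeTrace

end

theorem mainTheorem3 (Q : HeckeTrace.K) :
    (∃! Tr : (m : ℕ) → HeckeTrace.Hecke (m + 1) →ₗ[HeckeTrace.K] HeckeTrace.Hecke m,
      HeckeTrace.IsPartialTrace Q Tr) ∧
    ∀ Tr : (m : ℕ) → HeckeTrace.Hecke (m + 1) →ₗ[HeckeTrace.K] HeckeTrace.Hecke m,
      HeckeTrace.IsPartialTrace Q Tr →
      ∀ (n : ℕ) (T T' : HeckeTrace.StandardTableau n), T.shape = T'.shape →
        HeckeTrace.totalTrace Tr n (HeckeTrace.idempotent n T) =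
          HeckeTrace.totalTrace Tr n (HeckeTrace.idempotent n T') := by
  refine ⟨⟨_, HeckeTrace.isPartialTrace_partialTrace Q, fun Tr h => h.eq_partialTrace⟩, ?_⟩
  intro Tr h n T T' hs
  obtain rfl := h.eq_partialTrace
  -- Any N beyond the last row serves; it is chosen from the common shape, so both traces are
  -- compared with the same constant.
  obtain ⟨N, hN⟩ := HeckeTrace.exists_rowLen_eq_zero T.shape
  refine mul_right_cancel₀ (HeckeTrace.shapeTrace_zero_ne_zero Q N) ?_
  rw [HeckeTrace.totalTrace_idempotent Q n T hN, hs,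
    HeckeTrace.totalTrace_idempotent Q n T' (hs ▸ hN)]
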